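/- Let $\mathbb{F}$ be an algebraically closed field of characteristic $p>3$, let $m\ge 1$ and let $\underline{n}=(n_1,\dots,n_m)$ be a tuple of positive integers. Let $\mathcal{O}(m)$ be the divided power algebra over $\mathbb{F}$, with basis $x^{(\alpha)}$ ($\alpha\in\mathbb{N}^m$) and multiplication $x^{(\alpha)}x^{(\beta)}=\binom{\alpha+\beta}{\alpha}x^{(\alpha+\beta)}$, where $\binom{\alpha+\beta}{\alpha}=\prod_i\binom{\alpha_i+\beta_i}{\alpha_i}$; let $\mathcal{O}(m,\underline{n})$ be the subalgebra spanned by the $x^{(\alpha)}$ with $0\le\alpha_i<p^{n_i}$ for all $i$; let $D_1,\dots,D_m$ be the partial derivatives of $\mathcal{O}(m)$, given by $D_k(x^{(\alpha)})=x^{(\alpha-\epsilon_k)}$ (and $0$ if $\alpha_k=0$), where $\epsilon_k$ is the $k$-th unit multi-index. Let $W(m,\underline{n})=\bigoplus_{j=1}^m\mathcal{O}(m,\underline{n})D_j$ be the Witt algebra, a Lie subalgebra of $\operatorname{Der}\mathcal{O}(m)$, graded so that $x^{(\alpha)}D_j$ has degree $\alpha_1+\dots+\alpha_m-1$. A Lie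 algebra $L$ over $\mathbb{F}$ is said to be generated by one and a half elements if for every non-zero $x\in L$ there is $y\in L$ such that $x$ and $y$ generate $L$ as a Lie algebra. Then $W(m,\underline{n})$ is generated by one and a half elements if and only if $m=1$. Moreover, if $m>1$, then no element $x$ of the homogeneous component of maximal degree $\sum_i(p^{n_i}-1)-1$ of $W(m,\underline{n})$ lies in a generating pair: for every $y\in W(m,\underline{n})$, the Lie subalgebra generated by $x$ and $y$ is different from $W(m,\underline{n})$. -/

import Mathlib

noncomputable section

/-- The divided power algebra `O(m)` over `F`: the vector space with basis the divided monomials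
`x^(α)`, where `α` runs over the multi-indices in `ℕ^m`. -/
def DPAlg (F : Type*) [Field F] (m : ℕ) : Type _ := (Fin m → ℕ) →₀ F

namespace DPAlg

instance (F : Type*) [Field F] (m : ℕ) : AddCommGroup (DPAlg F m) :=
  inferInstanceAs (AddCommGroup ((Fin m → ℕ) →₀ F))

instance (F : Type*) [Field F] (m : ℕ) : Module F (DPAlg F m) :=
  inferInstanceAs (Module F ((Fin m → ℕ) →₀ F))

/-- The divided monomial `x^(α)`. -/
def mono (F : Type*) [Field F] {m : ℕ} (α : Fin m → ℕ) : DPAlg F m := Finsupp.single α (1 : F)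

/-- The divided monomials form a basis of `O(m)`. -/
def basis (F : Type*) [Field F] (m : ℕ) : Module.Basis (Fin m → ℕ) F (DPAlg F m) :=
  ⟨LinearEquiv.refl F ((Fin m → ℕ) →₀ F)⟩

theorem basis_apply (F : Type*) [Field F] {m : ℕ} (α : Fin m → ℕ) : basis F m α = mono F α := rfl

/-- The binomial coefficient `binom(α + β, α)` of multi-indices. -/
def binom {m : ℕ} (α β : Fin m → ℕ) : ℕ := ∏ i, (α i + β i).choose (α i)

theorem binom_comm {m : ℕ} (α β : Fin m → ℕ) : binom α β = binom β α := by
  unfold binom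
  refine Finset.prod_congr rfl fun i _ => ?_
  rw [add_comm (α i), Nat.choose_symm_add]

theorem binom_zero_left {m : ℕ} (β : Fin m → ℕ) : binom 0 β = 1 := by simp [binom]

theorem binom_assoc {m : ℕ} (α β γ : Fin m → ℕ) :
    binom α β * binom (α + β) γ = binom β γ * binom α (β + γ) := by
  unfold binom
  rw [← Finset.prod_mul_distrib, ← Finset.prod_mul_distrib]
  refine Finset.prod_congr rfl fun i _ => ?_
  simp only [Pi.add_apply]
  have h := Nat.add_choose_mul_factorial_mul_factorial (β i) (α i)
  have h1 := Nat.add_choose_mul_factorial_mul_factorial (γ i) (α i + β i)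
  have h2 := Nat.add_choose_mul_factorial_mul_factorial (γ i) (β i)
  have h3 := Nat.add_choose_mul_factorial_mul_factorial (β i + γ i) (α i)
  rw [add_comm (β i) (α i)] at h
  rw [add_comm (γ i) (α i + β i)] at h1
  rw [add_comm (γ i) (β i)] at h2
  rw [add_comm (β i + γ i) (α i), ← add_assoc] at h3
  have hpos : 0 < (α i).factorial * (β i).factorial * (γ i).factorial := by positivity
  refine Nat.eq_of_mul_eq_mul_right hpos ?_
  rw [← add_assoc]
  calc _ = (α i + β i + γ i).choose (α i + β i) * (γ i).factorial *
            ((α i + β i).choose (α i) * (β i).factorial * (α i).factorial) := by ring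
    _ = (α i + β i + γ i).factorial := by rw [h, ← h1]
    _ = (α i + β i + γ i).choose (α i) *
            ((β i + γ i).choose (β i) * (γ i).factorial * (β i).factorial) *
            (α i).factorial := by rw [h2, ← h3]
    _ = _ := by ring

/-- The multiplication of `O(m)`, determined by `x^(α) x^(β) = binom(α + β, α) x^(α + β)`. -/
def mulLin (F : Type*) [Field F] (m : ℕ) : DPAlg F m →ₗ[F] DPAlg F m →ₗ[F] DPAlg F m :=
  (basis F m).constr F fun α => (basis F m).constr F fun β => (binom α β : F) • mono F (α + β)

theorem mulLin_mono {F : Type*} [Field F] {m : ℕ} (α β : Fin m → ℕ) :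
    mulLin F m (mono F α) (mono F β) = (binom α β : F) • mono F (α + β) := by
  simp only [mulLin, ← basis_apply, Module.Basis.constr_basis]

theorem mulLin_comm {F : Type*} [Field F] {m : ℕ} (f g : DPAlg F m) :
    mulLin F m f g = mulLin F m g f := by
  have : mulLin F m = (mulLin F m).flip := by
    refine (basis F m).ext fun α => (basis F m).ext fun β => ?_
    simp only [basis_apply, LinearMap.flip_apply, mulLin_mono, binom_comm α β, add_comm α β]
  exact LinearMap.congr_fun₂ this f g

theorem mulLin_assoc {F : Type*} [Field F] {m : ℕ} (f g h : DPAlg F m) :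
    mulLin F m (mulLin F m f g) h = mulLin F m f (mulLin F m g h) := by
  have : (mulLin F m).compr₂ (mulLin F m) =
      ((LinearMap.llcomp F (DPAlg F m) (DPAlg F m) (DPAlg F m)).flip.comp (mulLin F m)).flip.comp
        (mulLin F m) := by
    refine (basis F m).ext fun α => (basis F m).ext fun β => (basis F m).ext fun γ => ?_
    simp only [basis_apply, LinearMap.compr₂_apply, LinearMap.comp_apply, LinearMap.flip_apply,
      LinearMap.llcomp_apply, mulLin_mono, map_smul, LinearMap.smul_apply, smul_smul, add_assoc]
    congr 1
    rw [← Nat.cast_mul, ← Nat.cast_mul, mul_comm (binom β γ), mul_comm (binom α β)]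
    exact congrArg Nat.cast (by linarith [binom_assoc α β γ])
  exact LinearMap.congr_fun (LinearMap.congr_fun₂ this f g) h

theorem one_mulLin {F : Type*} [Field F] {m : ℕ} (f : DPAlg F m) :
    mulLin F m (mono F 0) f = f := by
  have : mulLin F m (mono F 0) = LinearMap.id := by
    refine (basis F m).ext fun α => ?_
    simp [basis_apply, mulLin_mono, binom_zero_left]
  exact LinearMap.congr_fun this f

instance (F : Type*) [Field F] (m : ℕ) : CommRing (DPAlg F m) where
  __ := (inferInstance : AddCommGroup (DPAlg F m))
  mul f g := mulLin F m f g
  one := mono F 0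
  left_distrib f g h := map_add (mulLin F m f) g h
  right_distrib f g h := LinearMap.map_add₂ (mulLin F m) f g h
  zero_mul f := LinearMap.map_zero₂ (mulLin F m) f
  mul_zero f := map_zero (mulLin F m f)
  mul_assoc := mulLin_assoc
  one_mul := one_mulLin
  mul_one f := (mulLin_comm f (mono F 0)).trans (one_mulLin f)
  mul_comm := mulLin_comm

theorem mul_def {F : Type*} [Field F] {m : ℕ} (f g : DPAlg F m) : f * g = mulLin F m f g := rfl

theorem one_def {F : Type*} [Field F] {m : ℕ} : (1 : DPAlg F m) = mono F 0 := rfl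

instance (F : Type*) [Field F] (m : ℕ) : Algebra F (DPAlg F m) :=
  Algebra.ofModule (fun r f g => LinearMap.map_smul₂ (mulLin F m) r f g)
    (fun r f g => map_smul (mulLin F m f) r g)

theorem mono_mul_mono {F : Type*} [Field F] {m : ℕ} (α β : Fin m → ℕ) :
    mono F α * mono F β = (binom α β : F) • mono F (α + β) := mulLin_mono α β

/-- The partial derivative as a linear map: `x^(α) ↦ x^(α - ε_k)`, read as `0` if `α_k = 0`. -/
def partialLin (F : Type*) [Field F] {m : ℕ} (k : Fin m) : DPAlg F m →ₗ[F] DPAlg F m :=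
  (basis F m).constr F fun α => if α k = 0 then 0 else mono F (α - Pi.single k 1)

theorem partialLin_mono {F : Type*} [Field F] {m : ℕ} (k : Fin m) (α : Fin m → ℕ) :
    partialLin F k (mono F α) = if α k = 0 then 0 else mono F (α - Pi.single k 1) := by
  rw [partialLin, ← basis_apply, Module.Basis.constr_basis]

theorem binom_pascal {m : ℕ} (k : Fin m) (α β : Fin m → ℕ) (hα : α k ≠ 0) (hβ : β k ≠ 0) :
    binom α β = binom α (β - Pi.single k 1) + binom (α - Pi.single k 1) β := by
  unfold binom
  simp only [← Finset.mul_prod_erase Finset.univ _ (Finset.mem_univ k)]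
  have e1 : ∏ x ∈ Finset.univ.erase k,
      (α x + (β - Pi.single k 1 : Fin m → ℕ) x).choose (α x) =
        ∏ x ∈ Finset.univ.erase k, (α x + β x).choose (α x) :=
    Finset.prod_congr rfl fun x hx => by simp [Pi.single_eq_of_ne (Finset.ne_of_mem_erase hx)]
  have e2 : ∏ x ∈ Finset.univ.erase k,
      ((α - Pi.single k 1 : Fin m → ℕ) x + β x).choose ((α - Pi.single k 1 : Fin m → ℕ) x) =
        ∏ x ∈ Finset.univ.erase k, (α x + β x).choose (α x) :=
    Finset.prod_congr rfl fun x hx => by simp [Pi.single_eq_of_ne (Finset.ne_of_mem_erase hx)]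
  rw [e1, e2, ← add_mul]
  congr 1
  obtain ⟨a, ha⟩ := Nat.exists_eq_succ_of_ne_zero hα
  obtain ⟨b, hb⟩ := Nat.exists_eq_succ_of_ne_zero hβ
  simp only [Pi.sub_apply, Pi.single_eq_same, ha, hb, Nat.succ_eq_add_one, Nat.add_sub_cancel]
  rw [show a + 1 + (b + 1) = (a + b + 1) + 1 by ring, Nat.choose_succ_succ,
    show a + 1 + b = a + b + 1 by ring, show a + (b + 1) = a + b + 1 by ring, add_comm]

theorem binom_sub_of_zero {m : ℕ} (k : Fin m) (α β : Fin m → ℕ) (hα : α k = 0) :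
    binom α β = binom α (β - Pi.single k 1) := by
  unfold binom
  refine Finset.prod_congr rfl fun i _ => ?_
  rcases eq_or_ne i k with rfl | h
  · simp [hα]
  · simp [Pi.single_eq_of_ne h]

theorem add_sub_single {m : ℕ} (k : Fin m) (α β : Fin m → ℕ) (hβ : β k ≠ 0) :
    α + β - Pi.single k 1 = α + (β - Pi.single k 1) := by
  funext i
  rcases eq_or_ne i k with rfl | h
  · simp only [Pi.sub_apply, Pi.add_apply, Pi.single_eq_same]; omega
  · simp [Pi.single_eq_of_ne h]

theorem partialLin_leibniz_mono {F : Type*} [Field F] {m : ℕ} (k : Fin m) (α β : Fin m → ℕ) :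
    partialLin F k (mono F α * mono F β) =
      mono F α * partialLin F k (mono F β) + mono F β * partialLin F k (mono F α) := by
  rw [mono_mul_mono, map_smul, partialLin_mono, partialLin_mono, partialLin_mono]
  by_cases hα : α k = 0 <;> by_cases hβ : β k = 0
  · simp [hα, hβ]
  · rw [if_neg (by simp [hα, hβ]), if_neg hβ, if_pos hα, mul_zero, add_zero, mono_mul_mono,
      add_sub_single k α β hβ, binom_sub_of_zero k α β hα]
  · rw [if_neg (by simp [hα, hβ]), if_pos hβ, if_neg hα, mul_zero, zero_add, mono_mul_mono,
      add_comm α β, add_sub_single k β α hα, binom_comm, binom_sub_of_zero k β α hβ]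
  · rw [if_neg (by simp [hα]), if_neg hβ, if_neg hα, mono_mul_mono, mono_mul_mono,
      ← add_sub_single k α β hβ, ← add_sub_single k β α hα, add_comm β α, ← add_smul,
      binom_comm β, binom_pascal k α β hα hβ, Nat.cast_add]

theorem partialLin_leibniz {F : Type*} [Field F] {m : ℕ} (k : Fin m) (f g : DPAlg F m) :
    partialLin F k (f * g) = f * partialLin F k g + g * partialLin F k f := by
  have : (mulLin F m).compr₂ (partialLin F k) =
      (mulLin F m).compl₂ (partialLin F k) + ((mulLin F m).compl₂ (partialLin F k)).flip := by
    refine (basis F m).ext fun α => (basis F m).ext fun β => ?_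
    simpa [basis_apply, mul_def] using partialLin_leibniz_mono (F := F) k α β
  exact LinearMap.congr_fun₂ this f g

/-- The partial derivative `D_k` of `O(m)`, with `D_k (x^(α)) = x^(α - ε_k)`. -/
def partialD (F : Type*) [Field F] {m : ℕ} (k : Fin m) : Derivation F (DPAlg F m) (DPAlg F m) :=
  Derivation.mk' (partialLin F k) (partialLin_leibniz k)

theorem partialD_mono {F : Type*} [Field F] {m : ℕ} (k : Fin m) (α : Fin m → ℕ) :
    partialD F k (mono F α) = if α k = 0 then 0 else mono F (α - Pi.single k 1) :=
  partialLin_mono k α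

theorem partialD_comm {F : Type*} [Field F] {m : ℕ} (j k : Fin m) :
    ⁅partialD F j, partialD F k⁆ = 0 := by
  have : (partialLin F j).comp (partialLin F k) = (partialLin F k).comp (partialLin F j) := by
    refine (basis F m).ext fun α => ?_
    rcases eq_or_ne j k with rfl | h
    · rfl
    · simp only [basis_apply, LinearMap.comp_apply, partialLin_mono]
      by_cases hj : α j = 0 <;> by_cases hk : α k = 0 <;>
        simp [hj, hk, partialLin_mono, Pi.single_eq_of_ne h, Pi.single_eq_of_ne h.symm]
      rw [tsub_right_comm]
  ext f
  rw [Derivation.commutator_apply]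
  exact sub_eq_zero.2 (LinearMap.congr_fun this f)

/-- The linear span of the `x^(α)` with `0 ≤ α_i < p^{n_i}` for all `i`. -/
def truncSpan (F : Type*) [Field F] (p : ℕ) {m : ℕ} (n : Fin m → ℕ) : Submodule F (DPAlg F m) :=
  Submodule.span F {f | ∃ α : Fin m → ℕ, (∀ i, α i < p ^ n i) ∧ f = mono F α}

theorem binom_eq_zero (F : Type*) [Field F] (p : ℕ) [Fact p.Prime] [CharP F p] {m : ℕ}
    (n α β : Fin m → ℕ) (hα : ∀ i, α i < p ^ n i) (hβ : ∀ i, β i < p ^ n i) (i : Fin m)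
    (h : p ^ n i ≤ α i + β i) : (binom α β : F) = 0 := by
  rw [CharP.cast_eq_zero_iff F p]
  refine dvd_trans ?_ (Finset.dvd_prod_of_mem _ (Finset.mem_univ i))
  obtain ⟨c, hc⟩ := Nat.exists_eq_add_of_le h
  have hαi := hα i
  have hβi := hβ i
  rw [hc, Nat.add_choose_eq]
  refine Finset.dvd_sum fun x hx => ?_
  rw [Finset.HasAntidiagonal.mem_antidiagonal] at hx
  rcases eq_or_ne x.1 0 with h0 | h0
  · rw [Nat.choose_eq_zero_of_lt (show c < x.2 by omega), mul_zero]
    exact dvd_zero p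
  · exact Dvd.dvd.mul_right ((Fact.out : p.Prime).dvd_choose_pow h0 (by omega)) _

theorem truncSpan_mul (F : Type*) [Field F] (p : ℕ) [Fact p.Prime] [CharP F p] {m : ℕ}
    (n : Fin m → ℕ) {f g : DPAlg F m} (hf : f ∈ truncSpan F p n) (hg : g ∈ truncSpan F p n) :
    f * g ∈ truncSpan F p n := by
  unfold truncSpan at hf
  induction hf using Submodule.span_induction with
  | mem f hf =>
    obtain ⟨α, hα, rfl⟩ := hf
    unfold truncSpan at hg
    induction hg using Submodule.span_induction with
    | mem g hg =>
      obtain ⟨β, hβ, rfl⟩ := hg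
      rw [mono_mul_mono]
      by_cases h : ∀ i, α i + β i < p ^ n i
      · exact Submodule.smul_mem _ _ (Submodule.subset_span ⟨_, h, rfl⟩)
      · push Not at h
        obtain ⟨i, hi⟩ := h
        rw [binom_eq_zero F p n α β hα hβ i hi, zero_smul]
        exact zero_mem _
    | zero => rw [mul_zero]; exact zero_mem _
    | add a b _ _ ha hb => rw [mul_add]; exact add_mem ha hb
    | smul r a _ ha => rw [mul_smul_comm]; exact Submodule.smul_mem _ _ ha
  | zero => rw [zero_mul]; exact zero_mem _
  | add a b _ _ ha hb => rw [add_mul]; exact add_mem ha hb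
  | smul r a _ ha => rw [smul_mul_assoc]; exact Submodule.smul_mem _ _ ha

/-- The truncated divided power algebra `O(m, n)`, a subalgebra of `O(m)` in characteristic `p`. -/
def trunc (F : Type*) [Field F] (p : ℕ) [Fact p.Prime] [CharP F p] {m : ℕ} (n : Fin m → ℕ) :
    Subalgebra F (DPAlg F m) :=
  (truncSpan F p n).toSubalgebra
    (Submodule.subset_span ⟨0, fun i => pow_pos (Fact.out : p.Prime).pos (n i), rfl⟩)
    fun _ _ => truncSpan_mul F p n

theorem partialD_mem_trunc (F : Type*) [Field F] (p : ℕ) [Fact p.Prime] [CharP F p] {m : ℕ}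
    (n : Fin m → ℕ) (k : Fin m) {f : DPAlg F m} (hf : f ∈ trunc F p n) :
    partialD F k f ∈ trunc F p n := by
  change f ∈ truncSpan F p n at hf
  change partialD F k f ∈ truncSpan F p n
  unfold truncSpan at hf
  induction hf using Submodule.span_induction with
  | mem f hf =>
    obtain ⟨α, hα, rfl⟩ := hf
    rw [partialD_mono]
    split_ifs
    · exact zero_mem _
    · exact Submodule.subset_span
        ⟨_, fun i => lt_of_le_of_lt (Nat.sub_le _ _) (hα i), rfl⟩
  | zero => rw [map_zero]; exact zero_mem _
  | add a b _ _ ha hb => rw [map_add]; exact add_mem ha hb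
  | smul r a _ ha => rw [Derivation.map_smul]; exact Submodule.smul_mem _ _ ha

/-- The `O(m, n)`-submodule of `Der O(m)` generated by the partial derivatives `D_1, …, D_m`. -/
def wittModule (F : Type*) [Field F] (p : ℕ) [Fact p.Prime] [CharP F p] {m : ℕ}
    (n : Fin m → ℕ) : Submodule (trunc F p n) (Derivation F (DPAlg F m) (DPAlg F m)) :=
  Submodule.span (trunc F p n) (Set.range (partialD F (m := m)))

theorem wittModule_apply_mem (F : Type*) [Field F] (p : ℕ) [Fact p.Prime] [CharP F p] {m : ℕ}
    (n : Fin m → ℕ) {D : Derivation F (DPAlg F m) (DPAlg F m)} (hD : D ∈ wittModule F p n)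
    {f : DPAlg F m} (hf : f ∈ trunc F p n) : D f ∈ trunc F p n := by
  unfold wittModule at hD
  induction hD using Submodule.span_induction with
  | mem D hD => obtain ⟨k, rfl⟩ := hD; exact partialD_mem_trunc F p n k hf
  | zero => exact zero_mem _
  | add D E _ _ hD hE => exact add_mem hD hE
  | smul r D _ hD => exact mul_mem r.2 hD

theorem wittModule_lie_mem (F : Type*) [Field F] (p : ℕ) [Fact p.Prime] [CharP F p] {m : ℕ}
    (n : Fin m → ℕ) {D E : Derivation F (DPAlg F m) (DPAlg F m)} (hD : D ∈ wittModule F p n)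
    (hE : E ∈ wittModule F p n) : ⁅D, E⁆ ∈ wittModule F p n := by
  have key : ∀ (r : trunc F p n) (A B : Derivation F (DPAlg F m) (DPAlg F m)),
      A ∈ wittModule F p n → B ∈ wittModule F p n → ⁅A, B⁆ ∈ wittModule F p n →
      ⁅A, r • B⁆ ∈ wittModule F p n := by
    intro r A B hA hB hAB
    have e : ⁅A, r • B⁆ = (⟨A r, wittModule_apply_mem F p n hA r.2⟩ : trunc F p n) • B
        + r • ⁅A, B⁆ := by
      ext h
      change A (r.1 * B h) - r.1 * B (A h) = A r.1 * B h + r.1 * (A (B h) - B (A h))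
      rw [Derivation.leibniz, smul_eq_mul, smul_eq_mul]
      ring
    rw [e]
    exact add_mem (Submodule.smul_mem _ _ hB) (Submodule.smul_mem _ _ hAB)
  have h1 : ∀ (j : Fin m) {E}, E ∈ wittModule F p n → ⁅partialD F j, E⁆ ∈ wittModule F p n := by
    intro j E hE
    have hj : partialD F j ∈ wittModule F p n := Submodule.subset_span ⟨j, rfl⟩
    unfold wittModule at hE
    induction hE using Submodule.span_induction with
    | mem E hE => obtain ⟨k, rfl⟩ := hE; rw [partialD_comm]; exact zero_mem _
    | zero => rw [lie_zero]; exact zero_mem _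
    | add A B _ _ hA hB => rw [lie_add]; exact add_mem hA hB
    | smul r B hB ih => exact key r _ _ hj hB ih
  unfold wittModule at hD
  induction hD using Submodule.span_induction with
  | mem D hD => obtain ⟨k, rfl⟩ := hD; exact h1 k hE
  | zero => rw [zero_lie]; exact zero_mem _
  | add A B _ _ hA hB => rw [add_lie]; exact add_mem hA hB
  | smul r B hB ih =>
    rw [← lie_skew]
    exact neg_mem (key r _ _ hE hB (by rw [← lie_skew]; exact neg_mem ih))

end DPAlg

open DPAlg

/-- The Witt algebra `W(m, n)` over a field `F` of characteristic `p`: the Lie subalgebra of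
`Der O(m)` whose elements are the combinations `∑ f_j D_j` with `f_j ∈ O(m, n)`. -/
def WittAlg (F : Type*) [Field F] (p : ℕ) [Fact p.Prime] [CharP F p] {m : ℕ} (n : Fin m → ℕ) :
    LieSubalgebra F (Derivation F (DPAlg F m) (DPAlg F m)) where
  carrier := wittModule F p n
  add_mem' := add_mem
  zero_mem' := zero_mem _
  smul_mem' r D hD := by
    have e : r • D = (algebraMap F (trunc F p n) r) • D := by
      ext f; simp [Algebra.smul_def]
    rw [e]
    exact Submodule.smul_mem _ _ hD
  lie_mem' := wittModule_lie_mem F p n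

/-- The homogeneous component of degree `k` of `W(m, n)`: the span of the `x^(α) D_j` in `W(m, n)`
with `|α| - 1 = k`. -/
def WittAlg.component (F : Type*) [Field F] (p : ℕ) [Fact p.Prime] [CharP F p] {m : ℕ}
    (n : Fin m → ℕ) (k : ℤ) : Submodule F (WittAlg F p n) :=
  Submodule.span F {D | ∃ (α : Fin m → ℕ) (j : Fin m), (∀ i, α i < p ^ n i) ∧
    ((∑ i, α i : ℕ) : ℤ) - 1 = k ∧
    (D : Derivation F (DPAlg F m) (DPAlg F m)) = mono F α • partialD F j}

/-- The maximal degree `|τ| - 1` in the grading of `W(m, n)`, with `τ_i = p^{n_i} - 1`. -/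
def WittAlg.maxDegree (p : ℕ) {m : ℕ} (n : Fin m → ℕ) : ℤ :=
  (∑ i, ((p : ℤ) ^ n i - 1)) - 1

/-- A Lie algebra `L` over `F` is generated by one and a half elements if every non-zero `x ∈ L`
can be completed to a pair `x, y` that generates `L` as a Lie algebra. -/
def GeneratedByOneAndAHalf (F L : Type*) [Field F] [LieRing L] [LieAlgebra F L] : Prop :=
  ∀ x : L, x ≠ 0 → ∃ y : L, LieSubalgebra.lieSpan F L {x, y} = ⊤

end

/-! Write O for O(m, n), N for the sum of the n_i, so that dim O = p^N, and ev for evaluation at the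
origin.

Let m > 1, let x lie in the top component and let Y be the action of y on O. Then x acts as f ↦ l(f)
x^(τ) for a tangent vector l at the origin (`exists_of_mem_component_maxDegree`). Let J be the set
of f with ev(Y^k f) = 0 for all k; it is the largest Y-stable ideal inside the kernel of ev. If J ≠
0, then x^(τ) ∈ J (`exists_mul_eq_mon_topIndex`), so x and y both stabilise J. Were they generators,
the partial derivatives would lower x^(τ) to 1 inside J (`one_mem_of_stable`), but ev(1) = 1. If J =
0, the functionals ev ∘ Y^k with k < p^N are independent (`linearIndependent_dual_comp_pow`). Those
with k = p^i, i < N, are tangent vectors, because Y^(p^i) is a derivation; the tangent space has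
dimension at most N (`pointDer_ext`), so they span it. Hence l = ev ∘ E with E a combination of the
Y^(p^i), which commutes with Y (`exists_commuting_derivation`). Now x acts as x^(τ) E, so x and y
act inside the Lie algebra O E + F Y, whose dimension is at most p^N + 1, too small for the Witt
algebra (`not_forall_mem_spanPair`).

Let m = 1, r = p^n - 1, x = g D ≠ 0. A subalgebra that contains x^(r) D and an element with non-zero
constant term is everything (`eq_top_of_ev_ne_zero`); this settles g(0) ≠ 0 with y = x^(r) D.
Otherwise take y = (1 + c x^(r)) D and T = ad y. By `ad_pow_zass`, x = P(T) x^(r) D for a polynomial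
P ≠ 0, and y = (T^r - c) x^(r) D. If c is chosen so that P and X^r - c are coprime, a Bézout
relation puts x^(r) D in the subalgebra generated by x and y. -/

namespace DPAlg

/-! ### Monomial basis, evaluation and socle of O(m, n). -/

section Trunc

variable {F : Type*} [Field F] {p : ℕ} [Fact p.Prime] [CharP F p] {m : ℕ} {n : Fin m → ℕ}

open scoped Classical in
/-- The divided monomial `x^(α)` as an element of `O(m, n)`, read as `0` if `α` is not a
multi-index of `O(m, n)`. -/
noncomputable def mon (F : Type*) [Field F] (p : ℕ) [Fact p.Prime] [CharP F p] {m : ℕ}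
    (n α : Fin m → ℕ) : trunc F p n :=
  if h : ∀ i, α i < p ^ n i then ⟨mono F α, Submodule.subset_span ⟨α, h, rfl⟩⟩ else 0

theorem coe_mon {α : Fin m → ℕ} (h : ∀ i, α i < p ^ n i) :
    (mon F p n α : DPAlg F m) = mono F α := by
  rw [mon, dif_pos h]

theorem mon_eq_zero {α : Fin m → ℕ} (h : ¬ ∀ i, α i < p ^ n i) : mon F p n α = 0 := by
  rw [mon, dif_neg h]

theorem mon_zero : mon F p n 0 = 1 := by
  apply Subtype.ext
  rw [coe_mon (α := 0) fun i => pow_pos (Fact.out : p.Prime).pos (n i)]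
  rfl

theorem mon_mul_mon (α β : Fin m → ℕ) :
    mon F p n α * mon F p n β = (binom α β : F) • mon F p n (α + β) := by
  by_cases hα : ∀ i, α i < p ^ n i
  · by_cases hβ : ∀ i, β i < p ^ n i
    · by_cases h : ∀ i, (α + β) i < p ^ n i
      · apply Subtype.ext
        rw [MulMemClass.coe_mul, SetLike.val_smul, coe_mon hα, coe_mon hβ, coe_mon h,
          mono_mul_mono]
      · rw [mon_eq_zero h, smul_zero]
        push Not at h
        obtain ⟨i, hi⟩ := h
        apply Subtype.ext
        rw [MulMemClass.coe_mul, coe_mon hα, coe_mon hβ, mono_mul_mono,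
          binom_eq_zero F p n α β hα hβ i hi, zero_smul]
        rfl
    · rw [mon_eq_zero hβ, mon_eq_zero (α := α + β) fun h => hβ fun i => lt_of_le_of_lt (Nat.le_add_left _ _) (h i)]
      simp
  · rw [mon_eq_zero hα, mon_eq_zero (α := α + β) fun h => hα fun i => lt_of_le_of_lt (Nat.le_add_right _ _) (h i)]
    simp

/-- The coefficient at `x^(α)` of an element of `O(m, n)`. -/
noncomputable def coeff (F : Type*) [Field F] (p : ℕ) [Fact p.Prime] [CharP F p] {m : ℕ}
    (n α : Fin m → ℕ) : trunc F p n →ₗ[F] F :=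
  (basis F m).coord α ∘ₗ (trunc F p n).val.toLinearMap

theorem coeff_mon {α β : Fin m → ℕ} (hβ : ∀ i, β i < p ^ n i) :
    coeff F p n α (mon F p n β) = if β = α then 1 else 0 := by
  simp only [coeff, LinearMap.comp_apply, AlgHom.toLinearMap_apply, Subalgebra.coe_val,
    coe_mon hβ, ← basis_apply, Module.Basis.coord_apply, Module.Basis.repr_self]
  rw [Finsupp.single_apply]

theorem span_mon : Submodule.span F (Set.range fun a : ∀ i, Fin (p ^ n i) =>
    mon F p n fun i => (a i : ℕ)) = ⊤ := by
  rw [eq_top_iff]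
  rintro ⟨f, hf⟩ -
  have hf' : f ∈ Submodule.span F
      {f | ∃ α : Fin m → ℕ, (∀ i, α i < p ^ n i) ∧ f = mono F α} := hf
  induction hf' using Submodule.span_induction with
  | mem f h =>
    obtain ⟨α, hα, rfl⟩ := h
    refine Submodule.subset_span ⟨fun i => ⟨α i, hα i⟩, Subtype.ext ?_⟩
    exact coe_mon hα
  | zero => exact zero_mem _
  | add a b ha hb iha ihb => exact add_mem (iha ha) (ihb hb)
  | smul r a ha ih => exact Submodule.smul_mem _ r (ih ha)

theorem linearIndependent_mon : LinearIndependent F fun a : ∀ i, Fin (p ^ n i) =>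
    mon F p n fun i => (a i : ℕ) := by
  rw [Fintype.linearIndependent_iff]
  intro g hg a
  have := congrArg (coeff F p n fun i => (a i : ℕ)) hg
  rw [map_sum, map_zero, Finset.sum_eq_single a] at this
  · simpa [coeff_mon fun i => (a i).2] using this
  · intro b _ hb
    rw [map_smul, coeff_mon fun i => (b i).2, if_neg, smul_zero]
    exact fun h => hb (funext fun i => Fin.ext (congrFun h i))
  · simp

/-- The divided monomials form a basis of `O(m, n)`. -/
noncomputable def truncBasis (F : Type*) [Field F] (p : ℕ) [Fact p.Prime] [CharP F p] {m : ℕ}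
    (n : Fin m → ℕ) : Module.Basis (∀ i, Fin (p ^ n i)) F (trunc F p n) :=
  Module.Basis.mk linearIndependent_mon span_mon.ge

theorem truncBasis_apply (a : ∀ i, Fin (p ^ n i)) :
    truncBasis F p n a = mon F p n fun i => (a i : ℕ) := by
  rw [truncBasis, Module.Basis.mk_apply]

instance : FiniteDimensional F (trunc F p n) := (truncBasis F p n).finiteDimensional_of_finite

theorem finrank_trunc : Module.finrank F (trunc F p n) = p ^ ∑ i, n i := by
  rw [Module.finrank_eq_card_basis (truncBasis F p n), Fintype.card_pi, ← Finset.prod_pow_eq_pow_sum]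
  simp

theorem hom_ext {M : Type*} [AddCommGroup M] [Module F M] {S T : trunc F p n →ₗ[F] M}
    (h : ∀ α : Fin m → ℕ, (∀ i, α i < p ^ n i) → S (mon F p n α) = T (mon F p n α)) : S = T :=
  (truncBasis F p n).ext fun a => by
    rw [truncBasis_apply]; exact h _ fun i => (a i).2

theorem ext_coeff {f : trunc F p n} (h : ∀ α : Fin m → ℕ, (∀ i, α i < p ^ n i) →
    coeff F p n α f = 0) : f = 0 := by
  rw [← (truncBasis F p n).sum_repr f]
  refine Finset.sum_eq_zero fun a _ => ?_
  have : (truncBasis F p n).coord a = coeff F p n fun i => (a i : ℕ) := by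
    refine hom_ext fun α hα => ?_
    rw [coeff_mon hα, show mon F p n α = truncBasis F p n fun i => ⟨α i, hα i⟩ by
      rw [truncBasis_apply], Module.Basis.coord_apply, Module.Basis.repr_self, Finsupp.single_apply]
    congr 1
    simp only [funext_iff, Fin.ext_iff]
  rw [← Module.Basis.coord_apply, this, h _ fun i => (a i).2, zero_smul]

theorem coeff_mon_mul {α β : Fin m → ℕ} (hαβ : ∀ i, (α + β) i < p ^ n i) (f : trunc F p n) :
    coeff F p n (α + β) (mon F p n α * f) = (binom α β : F) * coeff F p n β f := by
  have : coeff F p n (α + β) ∘ₗ LinearMap.mulLeft F (mon F p n α) =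
      (binom α β : F) • coeff F p n β := by
    refine hom_ext fun γ hγ => ?_
    simp only [LinearMap.comp_apply, LinearMap.mulLeft_apply, LinearMap.smul_apply, mon_mul_mon,
      map_smul, coeff_mon hγ, smul_eq_mul]
    by_cases h : γ = β
    · subst h; simp [coeff_mon hαβ]
    · rw [if_neg h]
      by_cases h2 : ∀ i, (α + γ) i < p ^ n i
      · rw [coeff_mon h2, if_neg]; · simp
        simpa using h
      · rw [mon_eq_zero h2]; simp
  exact LinearMap.congr_fun this f

/-- Evaluation at the origin. -/
noncomputable def ev (F : Type*) [Field F] (p : ℕ) [Fact p.Prime] [CharP F p] {m : ℕ}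
    (n : Fin m → ℕ) : trunc F p n →ₗ[F] F := coeff F p n 0

theorem ev_mon {α : Fin m → ℕ} (h : α ≠ 0) : ev F p n (mon F p n α) = 0 := by
  by_cases hα : ∀ i, α i < p ^ n i
  · rw [ev, coeff_mon hα, if_neg h]
  · rw [mon_eq_zero hα, map_zero]

theorem ev_one : ev F p n 1 = 1 := by
  rw [ev, ← mon_zero, coeff_mon (β := 0) fun i => pow_pos (Fact.out : p.Prime).pos (n i), if_pos rfl]

theorem ev_mul (f g : trunc F p n) : ev F p n (f * g) = ev F p n f * ev F p n g := by
  have : (LinearMap.mul F (trunc F p n)).compr₂ (ev F p n) =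
      (LinearMap.mul F F).compl₁₂ (ev F p n) (ev F p n) := by
    refine hom_ext fun α hα => hom_ext fun β hβ => ?_
    simp only [LinearMap.compr₂_apply, LinearMap.mul_apply', LinearMap.compl₁₂_apply]
    by_cases h : α = 0
    · rw [h, mon_zero, one_mul, ev_one, one_mul]
    · rw [mon_mul_mon, map_smul, ev_mon h, ev_mon, smul_zero, zero_mul]
      intro h2
      exact h (funext fun i => (Nat.add_eq_zero_iff.1 (congrFun h2 i)).1)
  exact LinearMap.congr_fun₂ this f g

/-- The multi-index `τ` with `τ_i = p^{n_i} - 1`. -/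
def topIndex (p : ℕ) {m : ℕ} (n : Fin m → ℕ) : Fin m → ℕ := fun i => p ^ n i - 1

theorem le_topIndex {α : Fin m → ℕ} : α ≤ topIndex p n ↔ ∀ i, α i < p ^ n i :=
  forall_congr' fun i => by
    have := pow_pos (Fact.out : p.Prime).pos (n i)
    simp only [topIndex]; omega

/-- Every monomial other than 1 pushes x^(τ) out of the allowed range, so only the constant term of
f acts on it. -/
theorem mon_topIndex_mul (f : trunc F p n) :
    mon F p n (topIndex p n) * f = ev F p n f • mon F p n (topIndex p n) := by
  have : LinearMap.mulLeft F (mon F p n (topIndex p n)) =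
      (ev F p n).smulRight (mon F p n (topIndex p n)) := by
    refine hom_ext fun α hα => ?_
    simp only [LinearMap.mulLeft_apply, LinearMap.smulRight_apply]
    by_cases h : α = 0
    · rw [h, mon_zero, mul_one, ev_one, one_smul]
    · rw [ev_mon h, zero_smul, mon_mul_mon, mon_eq_zero, smul_zero]
      rw [← le_topIndex]
      intro h2
      refine h (funext fun i => ?_)
      have := h2 i
      simp only [Pi.add_apply] at this
      simp only [Pi.zero_apply]; omega
  exact LinearMap.congr_fun this f

/-- Pascal's rule and the vanishing of binom(p^k, a + 1) mod p force alternating signs, so the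
coefficient is (-1)^a in F. -/
theorem choose_pow_sub_one_ne_zero (F : Type*) [Field F] (p : ℕ) [Fact p.Prime] [CharP F p]
    (k : ℕ) {a : ℕ} (ha : a < p ^ k) : (((p ^ k - 1).choose a : ℕ) : F) ≠ 0 := by
  have key : ∀ a < p ^ k, (((p ^ k - 1).choose a : ℕ) : F) = (-1) ^ a := by
    intro a
    induction a with
    | zero => simp
    | succ a ih =>
      intro h
      have h1 : (p ^ k).choose (a + 1) = (p ^ k - 1).choose a + (p ^ k - 1).choose (a + 1) := by
        obtain ⟨q, hq⟩ := Nat.exists_eq_succ_of_ne_zero (show p ^ k ≠ 0 by omega)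
        rw [hq, Nat.succ_eq_add_one, Nat.choose_succ_succ, Nat.add_sub_cancel]
      have h2 : (((p ^ k).choose (a + 1) : ℕ) : F) = 0 :=
        (CharP.cast_eq_zero_iff F p _).2
          ((Fact.out : p.Prime).dvd_choose_pow (Nat.succ_ne_zero a) (by omega))
      rw [h1, Nat.cast_add, ih (by omega)] at h2
      rw [pow_succ]
      linear_combination h2
  rw [key a ha]
  exact pow_ne_zero _ (neg_ne_zero.2 one_ne_zero)

/-- Every non-zero ideal of `O(m, n)` contains `x^(τ)`. -/
theorem exists_mul_eq_mon_topIndex {f : trunc F p n} (hf : f ≠ 0) :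
    ∃ g, g * f = mon F p n (topIndex p n) := by
  classical
  -- Choose α of least total degree in the support of f. Multiplication by x^(τ - α) sends its term
  -- to a non-zero multiple of x^(τ) and kills all others.
  have hex : ∃ k, ∃ α : Fin m → ℕ, (∀ i, α i < p ^ n i) ∧ ∑ i, α i = k ∧ coeff F p n α f ≠ 0 := by
    by_contra! h
    exact hf (ext_coeff fun α hα => h _ α hα rfl)
  obtain ⟨α, hα, hk, hc⟩ := Nat.find_spec hex
  have hmin : ∀ β : Fin m → ℕ, ∑ i, β i < ∑ i, α i → (∀ i, β i < p ^ n i) →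
      coeff F p n β f = 0 := by
    intro β hβ hb
    by_contra h
    exact Nat.find_min hex (hk ▸ hβ) ⟨β, hb, rfl, h⟩
  set β := topIndex p n - α with hβ
  have hle := le_topIndex.2 hα
  have hsum : β + α = topIndex p n := tsub_add_cancel_of_le hle
  have hb : (binom β α : F) ≠ 0 := by
    rw [binom, Nat.cast_prod, Finset.prod_ne_zero_iff]
    intro i _
    have := congrFun hsum i
    rw [Pi.add_apply] at this
    rw [this]
    refine choose_pow_sub_one_ne_zero F p (n i) ?_
    exact le_topIndex.1 (show β ≤ topIndex p n from hsum ▸ le_self_add) i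
  refine ⟨((binom β α : F) * coeff F p n α f)⁻¹ • mon F p n β, ?_⟩
  rw [← sub_eq_zero]
  refine ext_coeff fun γ hγ => ?_
  rw [map_sub, smul_mul_assoc, map_smul, coeff_mon (le_topIndex.1 le_rfl), smul_eq_mul]
  by_cases h : β ≤ γ
  · obtain ⟨δ, rfl⟩ := exists_add_of_le h
    rw [coeff_mon_mul hγ]
    by_cases hδ : δ = α
    · rw [hδ, if_pos hsum.symm, inv_mul_cancel₀ (mul_ne_zero hb hc), sub_self]
    -- Here β + δ ≤ τ gives δ ≤ α, and δ ≠ α makes the degree of δ smaller, so minimality kills the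
    -- coefficient.
    · rw [if_neg fun h => hδ (add_left_cancel (h.symm.trans hsum.symm)), hmin δ, mul_zero,
        mul_zero, sub_zero]
      · have hδα : δ ≤ α := by
          rw [← add_le_add_iff_left β, hsum]; exact le_topIndex.2 hγ
        obtain ⟨i, hi⟩ := Function.ne_iff.1 hδ
        exact Finset.sum_lt_sum (fun i _ => hδα i) ⟨i, Finset.mem_univ i, lt_of_le_of_ne (hδα i) hi⟩
      · exact fun i => lt_of_le_of_lt (Nat.le_add_left _ _) (hγ i)
  · rw [if_neg, sub_zero]
    swap
    · rintro rfl; exact h (hsum ▸ le_self_add)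
    have : coeff F p n γ ∘ₗ LinearMap.mulLeft F (mon F p n β) = 0 := by
      refine hom_ext fun δ hδ => ?_
      simp only [LinearMap.comp_apply, LinearMap.mulLeft_apply, mon_mul_mon, map_smul,
        LinearMap.zero_apply]
      by_cases h2 : ∀ i, (β + δ) i < p ^ n i
      · rw [coeff_mon h2, if_neg, smul_zero]
        rintro rfl; exact h le_self_add
      · rw [mon_eq_zero h2, map_zero, smul_zero]
    have := LinearMap.congr_fun this f
    simp only [LinearMap.comp_apply, LinearMap.mulLeft_apply, LinearMap.zero_apply] at this
    rw [this, mul_zero]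

end Trunc

end DPAlg

/-! ### Powers of a derivation and derivations commuting with it. -/

/-- If the functionals `φ ∘ T^k` separate the points of `V`, the first `dim V` of them are linearly
independent. -/
theorem linearIndependent_dual_comp_pow {F V : Type*} [Field F] [AddCommGroup V] [Module F V]
    [FiniteDimensional F V] (φ : V →ₗ[F] F) (T : Module.End F V)
    (h : ∀ v, (∀ k, φ ((T ^ k) v) = 0) → v = 0) :
    LinearIndependent F fun k : Fin (Module.finrank F V) => φ ∘ₗ (T ^ (k : ℕ)) := by
  classical
  let Φ : V →ₗ[F] (Fin (Module.finrank F V) → F) := LinearMap.pi fun k => φ ∘ₗ (T ^ (k : ℕ))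
  have hinj : Function.Injective Φ := by
    refine (injective_iff_map_eq_zero Φ).2 fun v hv => h v fun k => ?_
    -- Cayley–Hamilton: every power of `T` is a combination of those below dim V, so vanishing of
    -- the first dim V functionals implies vanishing of all.
    have hT : T ^ k = Polynomial.aeval T (Polynomial.X ^ k %ₘ T.charpoly) := by
      rw [Polynomial.aeval_modByMonic_eq_self_of_root T.aeval_self_charpoly, map_pow,
        Polynomial.aeval_X]
    have hdeg := Polynomial.degree_modByMonic_lt (Polynomial.X ^ k) T.charpoly_monic
    rw [Polynomial.degree_eq_natDegree T.charpoly_monic.ne_zero, T.charpoly_natDegree] at hdeg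
    rw [hT, Polynomial.aeval_eq_sum_range, LinearMap.sum_apply, map_sum]
    refine Finset.sum_eq_zero fun i _ => ?_
    by_cases hi : i < Module.finrank F V
    · rw [LinearMap.smul_apply, map_smul, show φ ((T ^ i) v) = 0 from congrFun hv ⟨i, hi⟩,
        smul_zero]
    · rw [Polynomial.coeff_eq_zero_of_degree_lt (hdeg.trans_le (by exact_mod_cast not_lt.1 hi)),
        zero_smul, LinearMap.zero_apply, map_zero]
  have hsurj := (LinearMap.injective_iff_surjective_of_finrank_eq_finrank (by simp)).1 hinj
  rw [Fintype.linearIndependent_iff]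
  intro a ha k
  obtain ⟨v, hv⟩ := hsurj (Pi.single k 1)
  have := LinearMap.congr_fun ha v
  rw [LinearMap.sum_apply, Finset.sum_eq_single k] at this
  · rw [LinearMap.smul_apply, show (φ ∘ₗ T ^ (k : ℕ)) v = Φ v k from rfl, hv] at this
    simpa using this
  · intro j _ hj
    rw [LinearMap.smul_apply, show (φ ∘ₗ T ^ (j : ℕ)) v = Φ v j from rfl, hv,
      Pi.single_eq_of_ne hj, smul_zero]
  · simp

/-- The `p^k`-th power of a derivation in characteristic `p` is a derivation. -/
def Derivation.powCharPow {F A : Type*} [Field F] [CommRing A] [Algebra F A] (p : ℕ)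
    [Fact p.Prime] [CharP F p] (D : Derivation F A A) (k : ℕ) : Derivation F A A :=
  Derivation.mk' ((D : A →ₗ[F] A) ^ p ^ k : Module.End F A) <| by
    intro f g
    rcases subsingleton_or_nontrivial A with h | h
    · exact Subsingleton.elim _ _
    set T : Module.End F A := (D : A →ₗ[F] A)
    have : CharP (Module.End F (Module.End F A)) p :=
      charP_of_injective_algebraMap (algebraMap F _).injective p
    let l : Module.End F (Module.End F A) := LinearMap.mulLeft F T
    let r : Module.End F (Module.End F A) := LinearMap.mulRight F T
    have hlr : Commute l r := LinearMap.commute_mulLeft_right T T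
    -- `l - r` is the commutator with `T`. Since `l` and `r` commute, its p^k-th power is the
    -- commutator with T^(p^k). By `h2` this maps multiplication by f to multiplication by T^(p^k)
    -- f, which is the Leibniz rule.
    have h1 : (l - r) ^ p ^ k = l ^ p ^ k - r ^ p ^ k := 
      sub_pow_char_pow_of_commute (R := Module.End F (Module.End F A)) p k hlr
    have h2 : ∀ j, ((l - r) ^ j) (LinearMap.mulLeft F f) = LinearMap.mulLeft F ((T ^ j) f) := by
      intro j
      induction j with
      | zero => rfl
      | succ j ih =>
        rw [pow_succ', Module.End.mul_apply, ih, pow_succ', Module.End.mul_apply]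
        ext g
        simp [l, r, T, mul_comm]
    have h3 := h2 (p ^ k)
    rw [h1] at h3
    have h4 := LinearMap.congr_fun h3 g
    simp only [l, r, LinearMap.pow_mulLeft, LinearMap.pow_mulRight, LinearMap.sub_apply,
      LinearMap.mulLeft_apply, LinearMap.mulRight_apply, Module.End.mul_apply] at h4
    rw [smul_eq_mul, smul_eq_mul, mul_comm g, ← h4]
    ring

theorem Derivation.powCharPow_apply {F A : Type*} [Field F] [CommRing A] [Algebra F A] (p : ℕ)
    [Fact p.Prime] [CharP F p] (D : Derivation F A A) (k : ℕ) (f : A) :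
    D.powCharPow p k f = ((D : A →ₗ[F] A) ^ p ^ k : Module.End F A) f := rfl

/-- The combinations `f D + c E` of two commuting derivations form a Lie algebra. -/
def Derivation.spanPair {F A : Type*} [Field F] [CommRing A] [Algebra F A]
    (D E : Derivation F A A) (h : ⁅E, D⁆ = 0) : LieSubalgebra F (Derivation F A A) where
  carrier := {X | ∃ (f : A) (c : F), X = f • D + c • E}
  add_mem' := by
    rintro _ _ ⟨f, c, rfl⟩ ⟨g, d, rfl⟩
    exact ⟨f + g, c + d, by rw [add_smul, add_smul]; abel⟩
  zero_mem' := ⟨0, 0, by simp⟩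
  smul_mem' := by
    rintro r _ ⟨f, c, rfl⟩
    exact ⟨r • f, r * c, by rw [smul_add, smul_smul, smul_assoc]⟩
  lie_mem' := by
    rintro _ _ ⟨f, c, rfl⟩ ⟨g, d, rfl⟩
    -- As `E` and `D` commute and `c`, `d` are constants, the bracket has no `E` part.
    refine ⟨f * D g - g * D f + c • E g - d • E f, 0, ?_⟩
    ext a
    have ha : E (D a) = D (E a) := sub_eq_zero.1 <| by
      rw [← Derivation.commutator_apply, h, Derivation.zero_apply]
    simp only [Derivation.commutator_apply, Derivation.add_apply, Derivation.smul_apply, map_add,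
      Derivation.leibniz, smul_eq_mul, ha, Algebra.smul_def, map_zero, zero_mul, add_zero,
      Derivation.map_algebraMap, mul_zero]
    ring

/-- If no non-zero ideal inside the kernel of `ε` is stable under `D`, and if the tangent vectors
at `ε` are determined by their values at the family `v`, which is small enough, then each of them
comes from a combination of the derivations `D^{p^i}`. -/
theorem exists_commuting_derivation {F A : Type*} [Field F] [CommRing A] [Algebra F A]
    [FiniteDimensional F A] (p : ℕ) [Fact p.Prime] [CharP F p]
    (ε : A →ₐ[F] F) (D : Derivation F A A)
    (h : ∀ f, (∀ k, ε (((D : A →ₗ[F] A) ^ k : Module.End F A) f) = 0) → f = 0)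
    {ι : Type*} [Fintype ι] (v : ι → A) (hA : p ^ Fintype.card ι ≤ Module.finrank F A)
    (hv : ∀ l : A →ₗ[F] F, (∀ f g, l (f * g) = ε f * l g + ε g * l f) → (∀ i, l (v i) = 0) → l = 0)
    (l : A →ₗ[F] F) (hl : ∀ f g, l (f * g) = ε f * l g + ε g * l f) :
    ∃ E : Derivation F A A, ⁅D, E⁆ = 0 ∧ ∀ f, ε (E f) = l f := by
  have hp : p.Prime := Fact.out
  have hind := linearIndependent_dual_comp_pow ε.toLinearMap (D : A →ₗ[F] A) h
  set N := Fintype.card ι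
  have hlt : ∀ i : Fin N, p ^ (i : ℕ) < Module.finrank F A := fun i =>
    (Nat.pow_lt_pow_right hp.one_lt i.2).trans_le hA
  -- The hypothesis `hA` keeps the exponents p^i, i < N, below dim A, so these functionals are part
  -- of the independent family.
  have hind' := hind.comp (fun i : Fin N => ⟨p ^ (i : ℕ), hlt i⟩) fun i j hij =>
    Fin.ext (Nat.pow_right_injective hp.two_le (Fin.mk.inj hij))
  rw [Fintype.linearIndependent_iff] at hind'
  let E : (Fin N → F) → Derivation F A A := fun c => ∑ i, c i • D.powCharPow p i
  have hEapp : ∀ c f, ε (E c f) =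
      ∑ i, c i * ε (((D : A →ₗ[F] A) ^ p ^ (i : ℕ) : Module.End F A) f) := by
    intro c f
    have key : ∀ s : Finset (Fin N), ε ((∑ i ∈ s, c i • D.powCharPow p i) f) =
        ∑ i ∈ s, c i * ε (((D : A →ₗ[F] A) ^ p ^ (i : ℕ) : Module.End F A) f) := by
      classical
      intro s
      induction s using Finset.induction_on with
      | empty => simp
      | insert i s hi ih =>
        rw [Finset.sum_insert hi, Finset.sum_insert hi, Derivation.add_apply, map_add, ih,
          Derivation.smul_apply, map_smul, Derivation.powCharPow_apply, smul_eq_mul]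
    exact key _
  let Ψ : (Fin N → F) →ₗ[F] (ι → F) :=
    { toFun := fun c j => ε (E c (v j))
      map_add' := fun c d => by
        ext j; simp only [hEapp, Pi.add_apply, add_mul, Finset.sum_add_distrib]
      map_smul' := fun r c => by
        ext j
        simp only [hEapp, Pi.smul_apply, smul_eq_mul, mul_assoc, Finset.mul_sum, RingHom.id_apply] }
  -- A tangent vector ε ∘ E_c that vanishes on `v` is zero by `hv`, and then c = 0 by independence.
  -- As Ψ is square, it is also onto, so l can be matched on `v`.
  have hker : ∀ c, Ψ c = 0 → c = 0 := by
    intro c hc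
    have h0 := hv (ε.toLinearMap ∘ₗ (E c : A →ₗ[F] A)) (fun f g => by simp) fun j => congrFun hc j
    funext i
    refine hind' c (LinearMap.ext fun f => ?_) i
    have h1 := LinearMap.congr_fun h0 f
    have h2 := hEapp c f
    rw [show ε (E c f) = 0 from h1] at h2
    simpa using h2.symm
  have hsurj := (LinearMap.injective_iff_surjective_of_finrank_eq_finrank (f := Ψ)
    (by simp [N])).1 ((injective_iff_map_eq_zero Ψ).2 hker)
  obtain ⟨c, hc⟩ := hsurj fun j => l (v j)
  refine ⟨E c, ?_, fun f => ?_⟩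
  · have hcomm : ∀ i f, D (D.powCharPow p i f) = D.powCharPow p i (D f) := fun i f => by
      let T : Module.End F A := (D : A →ₗ[F] A)
      exact LinearMap.congr_fun ((Commute.refl T).pow_right (p ^ i)).eq f
    rw [lie_sum]
    refine Finset.sum_eq_zero fun i _ => ?_
    ext1 f
    rw [Derivation.commutator_apply, Derivation.smul_apply, Derivation.smul_apply,
      Derivation.map_smul, hcomm, sub_self, Derivation.zero_apply]
  · have h0 := hv (ε.toLinearMap ∘ₗ (E c : A →ₗ[F] A) - l)
      (fun f g => by
        simp only [LinearMap.sub_apply, hl f g, LinearMap.comp_apply, Derivation.coeFn_coe,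
          Derivation.leibniz, smul_eq_mul, AlgHom.toLinearMap_apply, map_add, map_mul]
        ring)
      fun j => sub_eq_zero.2 (congrFun hc j)
    exact sub_eq_zero.1 (LinearMap.congr_fun h0 f)

/-! ### Tangent vectors of O(m, n) at the origin. -/

namespace DPAlg

theorem choose_prime_pow_ne_zero (F : Type*) [Field F] (p : ℕ) [Fact p.Prime] [CharP F p]
    {a k : ℕ} (h1 : p ^ k ≤ a) (h2 : a < p ^ (k + 1)) : ((a.choose (p ^ k) : ℕ) : F) ≠ 0 := by
  have hp : p.Prime := Fact.out
  -- Lucas: the digits of p^k below place k are 0, so the coefficient is ⌊a / p^k⌋ mod p, which lies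
  -- strictly between 0 and p.
  have h := Choose.choose_modEq_choose_mul_prod_range_choose (p := p) (n := a) (k := p ^ k) k
  rw [Nat.div_self (pow_pos hp.pos k), Nat.choose_one_right, Finset.prod_eq_one, Nat.cast_one, mul_one] at h
  · rw [Ne, CharP.cast_eq_zero_iff F p, ← Int.natCast_dvd_natCast, ← Int.modEq_zero_iff_dvd]
    intro h0
    have h3 := h.symm.trans h0
    rw [Int.modEq_zero_iff_dvd, Int.natCast_dvd_natCast] at h3
    have h4 := Nat.le_of_dvd (Nat.div_pos h1 (pow_pos hp.pos k)) h3
    rw [Nat.le_div_iff_mul_le (pow_pos hp.pos k), ← pow_succ'] at h4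
    omega
  · intro i hi
    rw [Finset.mem_range] at hi
    rw [Nat.pow_div hi.le hp.pos, show k - i = k - i - 1 + 1 by omega, pow_succ, Nat.mul_mod_left,
      Nat.choose_zero_right]

section PointDerivation

variable {F : Type*} [Field F] {p : ℕ} [Fact p.Prime] [CharP F p] {m : ℕ} {n : Fin m → ℕ}

/-- With p^k the largest power of p not exceeding α_i, the factor x_i^(p^k) splits off with a
binomial coefficient that is invertible in F. So only the x_i^(p^j) can be indecomposable, and a
tangent vector kills products of two elements vanishing at the origin. -/
theorem exists_single_or_mul (α : Fin m → ℕ) (hα : ∀ i, α i < p ^ n i) (h0 : α ≠ 0) :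
    (∃ (i : Fin m) (j : Fin (n i)), α = Pi.single i (p ^ (j : ℕ))) ∨
      ∃ (β γ : Fin m → ℕ) (c : F), β ≠ 0 ∧ γ ≠ 0 ∧
        mon F p n α = c • (mon F p n β * mon F p n γ) := by
  have hp : p.Prime := Fact.out
  obtain ⟨i, hi⟩ := Function.ne_iff.1 h0
  rw [Pi.zero_apply] at hi
  set k := Nat.log p (α i)
  have h1 : p ^ k ≤ α i := Nat.pow_log_le_self p hi
  have h2 : α i < p ^ (k + 1) := Nat.lt_pow_succ_log_self hp.one_lt _
  set β : Fin m → ℕ := Pi.single i (p ^ k)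
  have hβ : β ≤ α := by
    intro j
    rcases eq_or_ne j i with rfl | hj
    · simpa [β] using h1
    · simp [β, Pi.single_eq_of_ne hj]
  have hsum : β + (α - β) = α := add_tsub_cancel_of_le hβ
  by_cases hγ : α - β = 0
  · left
    rw [hγ, add_zero] at hsum
    refine ⟨i, ⟨k, ?_⟩, hsum.symm⟩
    exact (Nat.pow_lt_pow_iff_right hp.one_lt).1 (h1.trans_lt (hα i))
  · right
    have hb : (binom β (α - β) : F) ≠ 0 := by
      rw [binom, Nat.cast_prod, Finset.prod_ne_zero_iff]
      intro j _
      have := congrFun hsum j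
      rw [Pi.add_apply] at this
      rw [this]
      rcases eq_or_ne j i with rfl | hj
      · simpa [β] using choose_prime_pow_ne_zero F p h1 h2
      · simp [β, Pi.single_eq_of_ne hj]
    refine ⟨β, α - β, (binom β (α - β) : F)⁻¹, ?_, hγ, ?_⟩
    · intro h
      have := congrFun h i
      simp only [β, Pi.single_eq_same, Pi.zero_apply] at this
      exact (pow_pos hp.pos k).ne' this
    · rw [mon_mul_mon, hsum, smul_smul, inv_mul_cancel₀ hb, one_smul]

/-- Evaluation at the origin as an algebra homomorphism. -/
noncomputable def evHom (F : Type*) [Field F] (p : ℕ) [Fact p.Prime] [CharP F p] {m : ℕ}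
    (n : Fin m → ℕ) : trunc F p n →ₐ[F] F :=
  AlgHom.ofLinearMap (ev F p n) ev_one ev_mul

/-- A tangent vector of `O(m, n)` at the origin is determined by its values at the generators
`x_i^(p^j)`. -/
theorem pointDer_ext (l : trunc F p n →ₗ[F] F)
    (hmul : ∀ f g, l (f * g) = evHom F p n f * l g + evHom F p n g * l f)
    (hl : ∀ s : Σ i, Fin (n i), l (mon F p n (Pi.single s.1 (p ^ (s.2 : ℕ)))) = 0) : l = 0 := by
  refine hom_ext fun α hα => ?_
  rw [LinearMap.zero_apply]
  rcases eq_or_ne α 0 with rfl | h0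
  · have h1 := hmul 1 1
    rw [mul_one, map_one (evHom F p n)] at h1
    rw [mon_zero]
    linear_combination -h1
  · rcases exists_single_or_mul (F := F) α hα h0 with ⟨i, j, rfl⟩ | ⟨β, γ, c, hβ, hγ, h⟩
    · exact hl ⟨i, j⟩
    · have h1 : evHom F p n (mon F p n β) = 0 := ev_mon hβ
      have h2 : evHom F p n (mon F p n γ) = 0 := ev_mon hγ
      rw [h, map_smul, hmul, h1, h2]; simp

end PointDerivation

end DPAlg

namespace DPAlg

/-! ### The action of W(m, n) on O(m, n) and the case m > 1. -/

section Witt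

variable {F : Type*} [Field F] {p : ℕ} [Fact p.Prime] [CharP F p] {m : ℕ} {n : Fin m → ℕ}

/-- The partial derivative `D_k` of `O(m, n)`. -/
noncomputable def tpartial (F : Type*) [Field F] (p : ℕ) [Fact p.Prime] [CharP F p] {m : ℕ}
    (n : Fin m → ℕ) (k : Fin m) : Derivation F (trunc F p n) (trunc F p n) :=
  Derivation.mk' ((partialLin F k).restrict fun _ hf => partialD_mem_trunc F p n k hf)
    fun f g => Subtype.ext (partialLin_leibniz k f.1 g.1)

theorem coe_tpartial (k : Fin m) (f : trunc F p n) :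
    (tpartial F p n k f : DPAlg F m) = partialD F k f := rfl

theorem tpartial_mon (k : Fin m) {α : Fin m → ℕ} (hα : ∀ i, α i < p ^ n i) :
    tpartial F p n k (mon F p n α) = if α k = 0 then 0 else mon F p n (α - Pi.single k 1) := by
  apply Subtype.ext
  rw [coe_tpartial, coe_mon hα, partialD_mono]
  split_ifs
  · rfl
  · rw [coe_mon (α := α - Pi.single k 1) fun i => lt_of_le_of_lt (Nat.sub_le _ _) (hα i)]

/-- The action of the Witt algebra on `O(m, n)`. -/
noncomputable def wittAction (F : Type*) [Field F] (p : ℕ) [Fact p.Prime] [CharP F p] {m : ℕ}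
    (n : Fin m → ℕ) : WittAlg F p n →ₗ⁅F⁆ Derivation F (trunc F p n) (trunc F p n) where
  toFun D := Derivation.mk'
    ((D.1 : DPAlg F m →ₗ[F] DPAlg F m).restrict fun _ hf => wittModule_apply_mem F p n D.2 hf)
    fun f g => Subtype.ext (D.1.leibniz f.1 g.1)
  map_add' D E := rfl
  map_smul' r D := rfl
  map_lie' {D E} := by
    ext1 f
    apply Subtype.ext
    exact Derivation.commutator_apply (D1 := D.1) (D2 := E.1) f.1

theorem coe_wittAction (D : WittAlg F p n) (f : trunc F p n) :
    (wittAction F p n D f : DPAlg F m) = D.1 f := rfl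

/-- The element `∑ f_j D_j` of the Witt algebra. -/
noncomputable def ofCoeffs (F : Type*) [Field F] (p : ℕ) [Fact p.Prime] [CharP F p] {m : ℕ}
    (n : Fin m → ℕ) : (Fin m → trunc F p n) →ₗ[F] WittAlg F p n where
  toFun f := ⟨∑ j, f j • partialD F j,
    Submodule.sum_mem _ fun j _ => Submodule.smul_mem _ (f j) (Submodule.subset_span ⟨j, rfl⟩)⟩
  map_add' f g := Subtype.ext <| by
    simp only [Pi.add_apply, add_smul, Finset.sum_add_distrib]; rfl
  map_smul' r f := Subtype.ext <| by
    simp only [Pi.smul_apply, smul_assoc, ← Finset.smul_sum]; rfl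

theorem ofCoeffs_surjective : Function.Surjective (ofCoeffs F p n) := by
  intro D
  obtain ⟨f, hf⟩ := (Submodule.mem_span_range_iff_exists_fun _).1
    (show D.1 ∈ Submodule.span (trunc F p n) (Set.range (partialD F (m := m))) from D.2)
  exact ⟨f, Subtype.ext hf⟩

theorem wittAction_ofCoeffs (f : Fin m → trunc F p n) :
    wittAction F p n (ofCoeffs F p n f) = ∑ j, f j • tpartial F p n j := by
  ext1 g
  apply Subtype.ext
  rw [coe_wittAction]
  change (∑ j, f j • partialD F j) g.1 = _
  have key : ∀ s : Finset (Fin m), (∑ j ∈ s, f j • partialD F j) g.1 =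
      ((∑ j ∈ s, f j • tpartial F p n j) g).1 := by
    classical
    intro s
    induction s using Finset.induction_on with
    | empty => rfl
    | insert i s hi ih =>
      rw [Finset.sum_insert hi, Finset.sum_insert hi, Derivation.add_apply, Derivation.add_apply, ih]
      rfl
  exact key _

theorem wittAction_ofCoeffs_single (j : Fin m) (f : trunc F p n) :
    wittAction F p n (ofCoeffs F p n (Pi.single j f)) = f • tpartial F p n j := by
  rw [wittAction_ofCoeffs, Finset.sum_eq_single j, Pi.single_eq_same]
  · intro i _ hi
    rw [Pi.single_eq_of_ne hi, zero_smul]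
  · exact fun h => absurd (Finset.mem_univ j) h

/-- The coefficients of a vector field are its values at the coordinates x_i, which lie in O(m, n)
because n_i ≥ 1. This makes the action faithful. -/
theorem wittAction_ofCoeffs_mon (hn : ∀ i, 1 ≤ n i) (f : Fin m → trunc F p n) (i : Fin m) :
    wittAction F p n (ofCoeffs F p n f) (mon F p n (Pi.single i 1)) = f i := by
  classical
  have hp : p.Prime := Fact.out
  have hb : ∀ j, (Pi.single i 1 : Fin m → ℕ) j < p ^ n j := fun j => by
    rcases eq_or_ne j i with rfl | hj
    · rw [Pi.single_eq_same]; exact Nat.one_lt_pow (by have := hn j; omega) hp.one_lt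
    · rw [Pi.single_eq_of_ne hj]; exact pow_pos hp.pos _
  have hcoe : ∀ s : Finset (Fin m), (∑ j ∈ s, f j • tpartial F p n j) (mon F p n (Pi.single i 1)) =
      ∑ j ∈ s, f j * tpartial F p n j (mon F p n (Pi.single i 1)) := by
    intro s
    induction s using Finset.induction_on with
    | empty => rfl
    | insert i s hi ih =>
      rw [Finset.sum_insert hi, Finset.sum_insert hi, Derivation.add_apply, ih]
      rfl
  rw [wittAction_ofCoeffs, hcoe, Finset.sum_eq_single i]
  · rw [tpartial_mon i hb, if_neg (by simp), tsub_self, mon_zero, mul_one]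
  · intro j _ hj
    rw [tpartial_mon j hb, if_pos (Pi.single_eq_of_ne hj _), mul_zero]
  · simp

theorem wittAction_injective (hn : ∀ i, 1 ≤ n i) : Function.Injective (wittAction F p n) := by
  intro D E h
  obtain ⟨f, rfl⟩ := ofCoeffs_surjective D
  obtain ⟨g, rfl⟩ := ofCoeffs_surjective E
  congr 1
  funext i
  rw [← wittAction_ofCoeffs_mon hn f, ← wittAction_ofCoeffs_mon hn g, h]

/-- The elements of the top component act by `f ↦ l(f) x^(τ)` with `l` a tangent vector at the
origin. -/
theorem exists_of_mem_component_maxDegree {D : WittAlg F p n}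
    (hD : D ∈ WittAlg.component F p n (WittAlg.maxDegree p n)) :
    ∃ l : trunc F p n →ₗ[F] F, (∀ f g, l (f * g) = evHom F p n f * l g + evHom F p n g * l f) ∧
      ∀ f, wittAction F p n D f = l f • mon F p n (topIndex p n) := by
  have hp : p.Prime := Fact.out
  unfold WittAlg.component at hD
  induction hD using Submodule.span_induction with
  | mem D hD =>
    obtain ⟨α, j, hα, hdeg, hD⟩ := hD
    -- α ≤ τ with equal total degree leaves only α = τ.
    have hατ : α = topIndex p n := by
      have hle := le_topIndex.2 hα
      have hsum : ∑ i, α i = ∑ i, topIndex p n i := by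
        have h1 : ((∑ i, topIndex p n i : ℕ) : ℤ) = ∑ i, ((p : ℤ) ^ n i - 1) := by
          rw [Nat.cast_sum]
          refine Finset.sum_congr rfl fun i _ => ?_
          rw [topIndex, Nat.cast_sub (Nat.one_le_pow _ _ hp.pos)]
          simp
        unfold WittAlg.maxDegree at hdeg
        omega
      exact funext fun i => (Finset.sum_eq_sum_iff_of_le fun i _ => hle i).1 hsum i
        (Finset.mem_univ i)
    refine ⟨ev F p n ∘ₗ (tpartial F p n j : trunc F p n →ₗ[F] trunc F p n), fun f g => ?_,
      fun f => ?_⟩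
    · change ev F p n (tpartial F p n j (f * g)) = ev F p n f * ev F p n (tpartial F p n j g) +
        ev F p n g * ev F p n (tpartial F p n j f)
      rw [Derivation.leibniz, map_add, smul_eq_mul, smul_eq_mul, ev_mul, ev_mul]
    · change _ = ev F p n (tpartial F p n j f) • _
      rw [← mon_topIndex_mul]
      apply Subtype.ext
      rw [coe_wittAction, hD, MulMemClass.coe_mul, coe_mon (le_topIndex.1 le_rfl), hατ]
      rfl
  | zero =>
    exact ⟨0, by simp, fun f => by
      rw [map_zero, Derivation.zero_apply, LinearMap.zero_apply, zero_smul]⟩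
  | add D E _ _ hD hE =>
    obtain ⟨a, ha, hD⟩ := hD
    obtain ⟨b, hb, hE⟩ := hE
    refine ⟨a + b, fun f g => ?_, fun f => ?_⟩
    · simp only [LinearMap.add_apply, ha f g, hb f g]; ring
    · rw [map_add, Derivation.add_apply, hD, hE, LinearMap.add_apply, add_smul]
  | smul r D _ hD =>
    obtain ⟨a, ha, hD⟩ := hD
    refine ⟨r • a, fun f g => ?_, fun f => ?_⟩
    · simp only [LinearMap.smul_apply, ha f g, smul_eq_mul]; ring
    · rw [map_smul, Derivation.smul_apply, hD, LinearMap.smul_apply, smul_assoc]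

/-- The derivations that stabilise a subspace. -/
def stabilizer {F A : Type*} [Field F] [CommRing A] [Algebra F A] (J : Submodule F A) :
    LieSubalgebra F (Derivation F A A) where
  carrier := {D | ∀ f ∈ J, D f ∈ J}
  add_mem' hD hE f hf := add_mem (hD f hf) (hE f hf)
  zero_mem' f _ := zero_mem J
  smul_mem' r D hD f hf := J.smul_mem r (hD f hf)
  lie_mem' {D E} hD hE f hf := by
    rw [Derivation.commutator_apply]
    exact sub_mem (hD _ (hE f hf)) (hE _ (hD f hf))

/-- Each D_i with α_i ≠ 0 lowers x^(α) to a monomial of total degree one less, until 1 is reached.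
-/
theorem one_mem_of_stable {J : Submodule F (trunc F p n)}
    (h : ∀ D f, f ∈ J → wittAction F p n D f ∈ J) (hJ : mon F p n (topIndex p n) ∈ J) :
    (1 : trunc F p n) ∈ J := by
  have key : ∀ k (α : Fin m → ℕ), (∀ i, α i < p ^ n i) → ∑ i, α i = k → mon F p n α ∈ J →
      (1 : trunc F p n) ∈ J := by
    intro k
    induction k with
    | zero =>
      intro α _ h0 hmem
      have : α = 0 := funext fun i => by
        simpa using (Finset.sum_eq_zero_iff.1 h0) i (Finset.mem_univ i)
      rwa [this, mon_zero] at hmem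
    | succ k ih =>
      intro α hα hk hmem
      obtain ⟨i, -, hi⟩ : ∃ i ∈ Finset.univ, α i ≠ 0 := by
        by_contra! h0
        rw [Finset.sum_eq_zero h0] at hk
        omega
      have h1 := h (ofCoeffs F p n (Pi.single i 1)) _ hmem
      rw [wittAction_ofCoeffs_single, one_smul, tpartial_mon i hα, if_neg hi] at h1
      refine ih _ (fun j => lt_of_le_of_lt (Nat.sub_le _ _) (hα j)) ?_ h1
      have h2 : (Pi.single i 1 : Fin m → ℕ) ≤ α := by
        intro j
        rcases eq_or_ne j i with rfl | hj
        · rw [Pi.single_eq_same]; exact Nat.one_le_iff_ne_zero.2 hi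
        · rw [Pi.single_eq_of_ne hj]; exact Nat.zero_le _
      have h3 : ∑ j, (α - Pi.single i 1 : Fin m → ℕ) j + ∑ j, (Pi.single i 1 : Fin m → ℕ) j = ∑ j, α j := by
        rw [← Finset.sum_add_distrib]
        exact Finset.sum_congr rfl fun j _ => congrFun (tsub_add_cancel_of_le h2) j
      rw [hk, Finset.sum_pi_single' i 1 Finset.univ, if_pos (Finset.mem_univ i)] at h3
      exact Nat.succ_injective h3
  exact key _ _ (le_topIndex.1 le_rfl) rfl hJ

/-- For `m > 1` the Witt algebra is not contained in `O(m, n) D + F E`, for dimension reasons. -/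
theorem not_forall_mem_spanPair (hm : 1 < m) (hn : ∀ i, 1 ≤ n i)
    (D E : Derivation F (trunc F p n) (trunc F p n)) (hDE : ⁅E, D⁆ = 0) :
    ¬ ∀ X, wittAction F p n X ∈ Derivation.spanPair D E hDE := by
  intro h
  let Ψ : trunc F p n × F →ₗ[F] Derivation F (trunc F p n) (trunc F p n) :=
    { toFun := fun a => a.1 • D + a.2 • E
      map_add' := fun a b => by
        rw [Prod.fst_add, Prod.snd_add, add_smul, add_smul]; abel
      map_smul' := fun r a => by
        rw [Prod.smul_fst, Prod.smul_snd, smul_add, smul_assoc, smul_assoc]; rfl }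
  let i₀ : Fin m := ⟨0, by omega⟩
  let i₁ : Fin m := ⟨1, hm⟩
  have hi : i₁ ≠ i₀ := fun h => by simpa [i₀, i₁] using congrArg Fin.val h
  -- Two coordinate directions already give a subspace of dimension 2 p^N; the map Ψ has a source of
  -- dimension p^N + 1.
  let Θ : trunc F p n × trunc F p n →ₗ[F] Derivation F (trunc F p n) (trunc F p n) :=
    (wittAction F p n : WittAlg F p n →ₗ[F] _) ∘ₗ ofCoeffs F p n ∘ₗ
      { toFun := fun a => Pi.single i₀ a.1 + Pi.single i₁ a.2
        map_add' := fun a b => by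
          rw [Prod.fst_add, Prod.snd_add, Pi.single_add, Pi.single_add]; abel
        map_smul' := fun r a => by
          rw [Prod.smul_fst, Prod.smul_snd, Pi.single_smul, Pi.single_smul, ← smul_add]; rfl }
  have hΘ : ∀ a, Θ a = 0 → a = 0 := by
    intro a ha
    have key : ∀ i, (Pi.single i₀ a.1 + Pi.single i₁ a.2 : Fin m → trunc F p n) i = 0 := fun i => by
      refine (wittAction_ofCoeffs_mon hn _ i).symm.trans ?_
      exact congrArg (fun X : Derivation F (trunc F p n) (trunc F p n) =>
        X (mon F p n (Pi.single i 1))) ha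
    have h0 := key i₀
    have h1 := key i₁
    rw [Pi.add_apply, Pi.single_eq_same, Pi.single_eq_of_ne hi.symm, add_zero] at h0
    rw [Pi.add_apply, Pi.single_eq_same, Pi.single_eq_of_ne hi, zero_add] at h1
    exact Prod.ext h0 h1
  have hrange : ∀ a, Θ a ∈ LinearMap.range Ψ := fun a => by
    obtain ⟨f, c, hfc⟩ := h (ofCoeffs F p n (Pi.single i₀ a.1 + Pi.single i₁ a.2))
    exact ⟨(f, c), hfc.symm⟩
  have hinj : Function.Injective (Θ.codRestrict (LinearMap.range Ψ) hrange) := by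
    exact (LinearMap.injective_codRestrict_iff hrange).2 ((injective_iff_map_eq_zero Θ).2 hΘ)
  have h1 := (LinearMap.finrank_le_finrank_of_injective hinj).trans (LinearMap.finrank_range_le Ψ)
  rw [Module.finrank_prod, Module.finrank_prod, Module.finrank_self, finrank_trunc] at h1
  have h2 : 1 < p ^ ∑ i, n i := Nat.one_lt_pow (by
    have := Finset.single_le_sum (f := n) (fun i _ => Nat.zero_le _) (Finset.mem_univ i₀)
    have := hn i₀
    omega) (Fact.out : p.Prime).one_lt
  omega

/-- For `m > 1` an element of the top component does not lie in a generating pair. -/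
theorem lieSpan_pair_ne_top (hm : 1 < m) (hn : ∀ i, 1 ≤ n i) {x : WittAlg F p n}
    (hx : x ∈ WittAlg.component F p n (WittAlg.maxDegree p n)) (y : WittAlg F p n) :
    LieSubalgebra.lieSpan F (WittAlg F p n) {x, y} ≠ ⊤ := by
  intro htop
  have hgen : ∀ K : LieSubalgebra F (Derivation F (trunc F p n) (trunc F p n)),
      wittAction F p n x ∈ K → wittAction F p n y ∈ K → ∀ D, wittAction F p n D ∈ K := by
    intro K hxK hyK D
    have h1 : LieSubalgebra.lieSpan F (WittAlg F p n) {x, y} ≤ K.comap (wittAction F p n) := by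
      rw [LieSubalgebra.lieSpan_le]
      rintro z (rfl | rfl)
      · exact hxK
      · exact hyK
    exact h1 (htop ▸ LieSubalgebra.mem_top D)
  obtain ⟨l, hl, hxl⟩ := exists_of_mem_component_maxDegree hx
  set Y := wittAction F p n y with hY
  -- The split is on whether the largest Y-stable ideal inside the maximal ideal vanishes.
  by_cases hJ : ∀ f, (∀ k, evHom F p n
      (((Y : trunc F p n →ₗ[F] trunc F p n) ^ k : Module.End F (trunc F p n)) f) = 0) → f = 0
  · obtain ⟨E, hE, hEl⟩ := exists_commuting_derivation p (evHom F p n) Y hJ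
      (fun s : Σ i, Fin (n i) => mon F p n (Pi.single s.1 (p ^ (s.2 : ℕ))))
      (by rw [finrank_trunc]; simp) pointDer_ext l hl
    refine not_forall_mem_spanPair hm hn E Y hE (hgen _ ?_ ?_)
    · refine ⟨mon F p n (topIndex p n), 0, ?_⟩
      rw [zero_smul, add_zero]
      ext1 f
      -- x^(τ) E(f) = ev(E f) x^(τ) = l(f) x^(τ): x acts as x^(τ) E.
      rw [hxl, Derivation.smul_apply, smul_eq_mul, mon_topIndex_mul, ← hEl]
      rfl
    · exact ⟨0, 1, by rw [zero_smul, one_smul, zero_add]⟩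
  · push Not at hJ
    obtain ⟨f, hf, hf0⟩ := hJ
    let T : Module.End F (trunc F p n) := (Y : trunc F p n →ₗ[F] trunc F p n)
    let J : Submodule F (trunc F p n) :=
      { carrier := {g | ∀ k, evHom F p n ((T ^ k) g) = 0}
        add_mem' := fun {a b} ha hb k => by rw [map_add, map_add, ha k, hb k, add_zero]
        zero_mem' := fun k => by rw [map_zero, map_zero]
        smul_mem' := fun r a ha k => by rw [map_smul, map_smul, ha k, smul_zero] }
    have hYJ : ∀ g ∈ J, T g ∈ J := fun g hg k => by
      have := hg (k + 1)
      rwa [pow_succ, Module.End.mul_apply] at this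
    -- J is an ideal: by Leibniz, Y(a g) is a combination of Y g and g, both in J, so the induction
    -- lowers k.
    have hmul : ∀ k, ∀ g ∈ J, ∀ a, evHom F p n ((T ^ k) (a * g)) = 0 := by
      intro k
      induction k with
      | zero =>
        intro g hg a
        have : evHom F p n g = 0 := hg 0
        rw [pow_zero, Module.End.one_apply, map_mul, this, mul_zero]
      | succ k ih =>
        intro g hg a
        have : T (a * g) = a * T g + T a * g := by
          change Y (a * g) = a * Y g + Y a * g
          rw [Derivation.leibniz, smul_eq_mul, smul_eq_mul, mul_comm g]
        rw [pow_succ, Module.End.mul_apply, this, map_add, map_add, ih _ (hYJ g hg), ih _ hg,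
          add_zero]
    obtain ⟨a, ha⟩ := exists_mul_eq_mon_topIndex hf0
    have hτ : mon F p n (topIndex p n) ∈ J := fun k => by
      rw [← ha]; exact hmul k f hf a
    -- x maps all of O(m, n) into the line of x^(τ), which lies in J.
    have hstab := hgen (stabilizer J) (fun g _ => by rw [hxl]; exact J.smul_mem _ hτ) hYJ
    have h1 : (1 : trunc F p n) ∈ J := one_mem_of_stable (fun D g hg => hstab D g hg) hτ
    have h2 := h1 0
    rw [pow_zero, Module.End.one_apply, map_one] at h2
    exact one_ne_zero h2

end Witt

end DPAlg

/-! ### Polynomial tools for the case m = 1. -/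

theorem Submodule.aeval_apply_mem {F V : Type*} [Field F] [AddCommGroup V] [Module F V]
    {S : Submodule F V} {T : Module.End F V} (hT : ∀ v ∈ S, T v ∈ S) (a : Polynomial F) {v : V}
    (hv : v ∈ S) : Polynomial.aeval T a v ∈ S := by
  have hpow : ∀ i, (T ^ i) v ∈ S := by
    intro i
    induction i with
    | zero => exact hv
    | succ i ih => rw [pow_succ', Module.End.mul_apply]; exact hT _ ih
  rw [Polynomial.aeval_eq_sum_range, LinearMap.sum_apply]
  exact Submodule.sum_mem _ fun i _ => S.smul_mem _ (hpow i)

/-- A common root a of both polynomials gives c = a^r, so c only has to avoid the r-th powers of the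
finitely many roots of `P`; the field is infinite. -/
theorem Polynomial.exists_isCoprime_X_pow_sub_C {F : Type*} [Field F] [IsAlgClosed F]
    {P : Polynomial F} (hP : P ≠ 0) (r : ℕ) :
    ∃ c : F, IsCoprime P (Polynomial.X ^ r - Polynomial.C c) := by
  classical
  obtain ⟨c, hc⟩ := Infinite.exists_notMem_finset (P.roots.toFinset.image (· ^ r))
  refine ⟨c, (Polynomial.isCoprime_iff_aeval_ne_zero_of_isAlgClosed F F _ _).2 fun a => ?_⟩
  by_contra! h
  refine hc (Finset.mem_image.2 ⟨a, ?_, ?_⟩)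
  · rw [Multiset.mem_toFinset, Polynomial.mem_roots hP]
    simpa using h.1
  · have := h.2
    simp only [map_sub, map_pow, Polynomial.aeval_X, Polynomial.aeval_C, sub_eq_zero] at this
    exact this

/-! ### The Zassenhaus algebra W(1, n). -/

namespace DPAlg

section Zassenhaus

variable {F : Type*} [Field F] {p : ℕ} [Fact p.Prime] [CharP F p] {n : Fin 1 → ℕ}

/-- The divided power `x^(k)` in `O(1, n)`. -/
noncomputable def divPow (F : Type*) [Field F] (p : ℕ) [Fact p.Prime] [CharP F p]
    (n : Fin 1 → ℕ) (k : ℕ) : trunc F p n := mon F p n fun _ => k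

/-- The element `f D_1` of the Zassenhaus algebra. -/
noncomputable def zass (F : Type*) [Field F] (p : ℕ) [Fact p.Prime] [CharP F p]
    (n : Fin 1 → ℕ) : trunc F p n →ₗ[F] WittAlg F p n :=
  ofCoeffs F p n ∘ₗ LinearMap.pi fun _ => LinearMap.id

theorem zass_surjective : Function.Surjective (zass F p n) := by
  intro D
  obtain ⟨f, rfl⟩ := ofCoeffs_surjective D
  have hf : f = fun _ => f 0 := funext fun i => by rw [Subsingleton.elim i 0]
  refine ⟨f 0, ?_⟩
  rw [hf]
  rfl

theorem wittAction_zass (f : trunc F p n) :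
    wittAction F p n (zass F p n f) = f • tpartial F p n 0 := by
  change wittAction F p n (ofCoeffs F p n fun _ => f) = _
  rw [wittAction_ofCoeffs]
  exact Fin.sum_univ_one _

theorem lie_zass (hn : ∀ i, 1 ≤ n i) (f g : trunc F p n) :
    ⁅zass F p n f, zass F p n g⁆ =
      zass F p n (f * tpartial F p n 0 g - g * tpartial F p n 0 f) := by
  apply wittAction_injective hn
  rw [LieHom.map_lie, wittAction_zass, wittAction_zass, wittAction_zass]
  ext1 a
  simp only [Derivation.commutator_apply, Derivation.smul_apply, smul_eq_mul, Derivation.leibniz]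
  ring

theorem divPow_zero : divPow F p n 0 = 1 := mon_zero

theorem divPow_eq_zero {k : ℕ} (hk : p ^ n 0 ≤ k) : divPow F p n k = 0 :=
  mon_eq_zero fun h => absurd (h 0) (not_lt.2 hk)

theorem divPow_mul_divPow (j k : ℕ) :
    divPow F p n j * divPow F p n k = ((j + k).choose j : F) • divPow F p n (j + k) := by
  rw [divPow, divPow, mon_mul_mon]
  simp only [binom, Finset.univ_unique, Finset.prod_singleton]
  rfl

theorem tpartial_divPow {k : ℕ} (hk : k + 1 < p ^ n 0) :
    tpartial F p n 0 (divPow F p n (k + 1)) = divPow F p n k := by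
  rw [divPow, tpartial_mon 0 fun i => by rw [Subsingleton.elim i 0]; exact hk,
    if_neg (Nat.succ_ne_zero k), divPow]
  congr 1
  funext i
  rw [Subsingleton.elim i 0, Pi.sub_apply, Pi.single_eq_same, Nat.add_sub_cancel]

theorem eq_sum_divPow (f : trunc F p n) : f = ∑ k ∈ Finset.range (p ^ n 0),
    coeff F p n (fun _ => k) f • divPow F p n k := by
  have : LinearMap.id = ∑ k ∈ Finset.range (p ^ n 0),
      (coeff F p n fun _ => k).smulRight (divPow F p n k) := by
    refine hom_ext fun α hα => ?_
    have hα0 : α = fun _ => α 0 := funext fun i => by rw [Subsingleton.elim i 0]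
    rw [LinearMap.sum_apply, Finset.sum_eq_single (α 0)]
    · rw [LinearMap.smulRight_apply, coeff_mon hα, if_pos hα0, one_smul, divPow, ← hα0]
      rfl
    · intro k _ hk
      rw [LinearMap.smulRight_apply, coeff_mon hα, if_neg, zero_smul]
      intro h
      exact hk (congrFun h 0).symm
    · intro h
      exact absurd (Finset.mem_range.2 (hα 0)) h
  have h1 := LinearMap.congr_fun this f
  rw [LinearMap.sum_apply] at h1
  exact h1

theorem eq_top_of_forall_divPow {G : LieSubalgebra F (WittAlg F p n)}
    (h : ∀ k < p ^ n 0, zass F p n (divPow F p n k) ∈ G) : G = ⊤ := by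
  rw [eq_top_iff]
  intro D _
  obtain ⟨f, rfl⟩ := zass_surjective D
  rw [eq_sum_divPow f, map_sum]
  refine sum_mem fun k hk => ?_
  rw [map_smul]
  exact G.smul_mem _ (h k (Finset.mem_range.1 hk))

/-- A subalgebra of the Zassenhaus algebra that contains the top component and an element with
non-zero constant term is the whole algebra. -/
theorem eq_top_of_ev_ne_zero (hn : ∀ i, 1 ≤ n i) {G : LieSubalgebra F (WittAlg F p n)}
    {g : trunc F p n} (hg : ev F p n g ≠ 0) (hgG : zass F p n g ∈ G)
    (htop : zass F p n (divPow F p n (p ^ n 0 - 1)) ∈ G) : G = ⊤ := by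
  have hq : 0 < p ^ n 0 := pow_pos (Fact.out : p.Prime).pos _
  -- Downward induction from the top: the bracket of g D with x^(k+1) D is g(0) x^(k) D plus terms
  -- of higher exponent, already in `G`.
  have key : ∀ j, ∀ k < p ^ n 0, p ^ n 0 - 1 - j ≤ k → zass F p n (divPow F p n k) ∈ G := by
    intro j
    induction j with
    | zero =>
      intro k hk hjk
      rwa [show k = p ^ n 0 - 1 by omega]
    | succ j ih =>
      intro k hk hjk
      by_cases hk' : p ^ n 0 - 1 - j ≤ k
      · exact ih k hk hk'
      have hk1 : k + 1 < p ^ n 0 := by omega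
      have hih : ∀ i, k < i → zass F p n (divPow F p n i) ∈ G := by
        intro i hi
        by_cases hiq : i < p ^ n 0
        · exact ih i hiq (by omega)
        · rw [divPow_eq_zero (not_lt.1 hiq), map_zero]
          exact G.zero_mem
      have hlie := G.lie_mem hgG (ih (k + 1) hk1 (by omega))
      let B : trunc F p n →ₗ[F] WittAlg F p n := zass F p n ∘ₗ
        (LinearMap.mulRight F (divPow F p n k) - LinearMap.mulLeft F (divPow F p n (k + 1)) ∘ₗ
          (tpartial F p n 0 : trunc F p n →ₗ[F] trunc F p n))
      have hBapp : ∀ a, B a = zass F p n (a * divPow F p n k -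
          divPow F p n (k + 1) * tpartial F p n 0 a) := fun _ => rfl
      have hB : ⁅zass F p n g, zass F p n (divPow F p n (k + 1))⁆ = B g := by
        rw [lie_zass hn, tpartial_divPow hk1, hBapp]
      obtain ⟨r, hr⟩ := Nat.exists_eq_succ_of_ne_zero hq.ne'
      rw [hB, eq_sum_divPow g, hr, Nat.succ_eq_add_one, Finset.sum_range_succ', map_add, map_sum]
        at hlie
      have h0 : B (coeff F p n (fun _ => 0) g • divPow F p n 0) =
          ev F p n g • zass F p n (divPow F p n k) := by
        have hev : coeff F p n (fun _ => 0) g = ev F p n g := rfl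
        rw [map_smul, hev, hBapp, divPow_zero, Derivation.map_one_eq_zero, mul_zero, sub_zero,
          one_mul]
      rw [h0] at hlie
      have h1 : ∑ i ∈ Finset.range r,
          B (coeff F p n (fun _ => i + 1) g • divPow F p n (i + 1)) ∈ G := by
        refine sum_mem fun i hi => ?_
        rw [Finset.mem_range] at hi
        rw [map_smul]
        refine G.smul_mem _ ?_
        rw [hBapp, tpartial_divPow (by omega), divPow_mul_divPow, divPow_mul_divPow, map_sub, map_smul,
          map_smul]
        exact sub_mem (G.smul_mem _ (hih _ (by omega))) (G.smul_mem _ (hih _ (by omega)))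
      have h2 := (add_mem_cancel_left h1).1 hlie
      have h3 := G.smul_mem (ev F p n g)⁻¹ h2
      rwa [smul_smul, inv_mul_cancel₀ hg, one_smul] at h3
  exact eq_top_of_forall_divPow fun k hk => key (p ^ n 0 - 1) k hk (by omega)

/-- The action of `D_1 + c x^(q - 1) D_1`, where `q = r + 1` is the dimension, on `x^(r) D_1`. -/
theorem ad_pow_zass (hn : ∀ i, 1 ≤ n i) {r : ℕ} (hr : p ^ n 0 = r + 1) (h2 : 2 ≤ r) (c : F) :
    (∀ i < r, ((LieAlgebra.ad F _ (zass F p n (1 + c • divPow F p n r))) ^ i)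
      (zass F p n (divPow F p n r)) = zass F p n (divPow F p n (r - i))) ∧
    ((LieAlgebra.ad F _ (zass F p n (1 + c • divPow F p n r))) ^ r)
      (zass F p n (divPow F p n r)) = zass F p n (1 + (2 * c) • divPow F p n r) := by
  obtain ⟨s, rfl⟩ : ∃ s, r = s + 1 := ⟨r - 1, by omega⟩
  set T := LieAlgebra.ad F (WittAlg F p n) (zass F p n (1 + c • divPow F p n (s + 1))) with hT
  have hd : tpartial F p n 0 (1 + c • divPow F p n (s + 1)) = c • divPow F p n s := by
    rw [map_add, Derivation.map_one_eq_zero, zero_add, Derivation.map_smul,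
      tpartial_divPow (by omega)]
  have hstep : ∀ k, k < s + 1 → T (zass F p n (divPow F p n (k + 1))) =
      zass F p n (divPow F p n k + c • (divPow F p n (s + 1) * divPow F p n k -
        divPow F p n (k + 1) * divPow F p n s)) := by
    intro k hk
    rw [hT, LieAlgebra.ad_apply, lie_zass hn, hd, tpartial_divPow (by omega)]
    congr 1
    rw [add_mul, one_mul, smul_mul_assoc, mul_smul_comm, smul_sub]
    abel
  have h1 : ∀ i < s + 1, (T ^ i) (zass F p n (divPow F p n (s + 1))) =
      zass F p n (divPow F p n (s + 1 - i)) := by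
    intro i
    induction i with
    | zero => intro _; rfl
    | succ i ih =>
      intro hi
      -- As long as the new exponent k + 1 is positive, both correction products have exponent at
      -- least q = s + 2 and vanish.
      obtain ⟨k, hk⟩ : ∃ k, s + 1 - i = k + 1 + 1 := ⟨s - 1 - i, by omega⟩
      rw [pow_succ', Module.End.mul_apply, ih (by omega), hk, hstep _ (by omega),
        divPow_mul_divPow, divPow_mul_divPow, divPow_eq_zero (k := s + 1 + (k + 1)) (by omega),
        divPow_eq_zero (k := k + 1 + 1 + s) (by omega), smul_zero, smul_zero, sub_zero, smul_zero,
        add_zero, show s + 1 - (i + 1) = k + 1 by omega]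
  refine ⟨h1, ?_⟩
  rw [pow_succ', Module.End.mul_apply, h1 s (by omega), show s + 1 - s = 0 + 1 by omega,
    hstep 0 (by omega), divPow_zero, mul_one, zero_add, divPow_mul_divPow, Nat.choose_one_right,
    add_comm 1 s]
  -- In the last step x^(1) x^(s) = (s + 1) x^(s+1) = -x^(s+1), so the two correction terms add up
  -- to 2c.
  have hs : ((s + 1 : ℕ) : F) = -1 := by
    have h0 : ((p ^ n 0 : ℕ) : F) = 0 := by
      rw [Nat.cast_pow, CharP.cast_eq_zero, zero_pow (by have := hn 0; omega)]
    rw [hr, Nat.cast_add, Nat.cast_one] at h0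
    linear_combination h0
  rw [hs, neg_smul, one_smul, sub_neg_eq_add, smul_add, ← add_smul, ← two_mul]

/-- The Zassenhaus algebra is generated by one and a half elements. -/
theorem generatedByOneAndAHalf_zassenhaus [IsAlgClosed F] (hp : 3 < p) (hn : ∀ i, 1 ≤ n i) :
    GeneratedByOneAndAHalf F (WittAlg F p n) := by
  intro x hx
  obtain ⟨g, rfl⟩ := zass_surjective x
  have hq : 3 < p ^ n 0 := hp.trans_le (Nat.le_self_pow (by have := hn 0; omega) p)
  obtain ⟨r, hr⟩ : ∃ r, p ^ n 0 = r + 1 := ⟨p ^ n 0 - 1, by omega⟩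
  by_cases hg : ev F p n g ≠ 0
  · refine ⟨zass F p n (divPow F p n (p ^ n 0 - 1)), eq_top_of_ev_ne_zero hn hg ?_ ?_⟩
    · exact LieSubalgebra.subset_lieSpan (Set.mem_insert _ _)
    · exact LieSubalgebra.subset_lieSpan (Set.mem_insert_of_mem _ rfl)
  push Not at hg
  -- The reversed indexing matches T^i x^(r) D = x^(r-i) D. Only i < r occurs because g has no
  -- constant term.
  let a : ℕ → F := fun i => coeff F p n (fun _ => r - i) g
  have hga : g = ∑ i ∈ Finset.range r, a i • divPow F p n (r - i) := by
    have h0 : coeff F p n (fun _ => 0) g = 0 := hg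
    conv_lhs => rw [eq_sum_divPow g, hr, Finset.sum_range_succ', h0, zero_smul, add_zero,
      ← Finset.sum_range_reflect]
    refine Finset.sum_congr rfl fun i hi => ?_
    rw [Finset.mem_range] at hi
    rw [show r - 1 - i + 1 = r - i by omega]
  let P : Polynomial F := ∑ i ∈ Finset.range r, Polynomial.monomial i (a i)
  have hP : P ≠ 0 := by
    intro h
    refine hx ?_
    rw [hga, Finset.sum_eq_zero, map_zero]
    intro i hi
    have := congrArg (fun Q => Polynomial.coeff Q i) h
    simp only [P, Polynomial.finsetSum_coeff, Polynomial.coeff_monomial, Finset.sum_ite_eq',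
      Polynomial.coeff_zero, if_pos hi] at this
    rw [this, zero_smul]
  obtain ⟨c, A, B, hAB⟩ := Polynomial.exists_isCoprime_X_pow_sub_C hP r
  refine ⟨zass F p n (1 + c • divPow F p n r), ?_⟩
  set x := zass F p n g with hxg
  set y := zass F p n (1 + c • divPow F p n r) with hy
  set G := LieSubalgebra.lieSpan F (WittAlg F p n) {x, y}
  have hxG : x ∈ G := LieSubalgebra.subset_lieSpan (Set.mem_insert _ _)
  have hyG : y ∈ G := LieSubalgebra.subset_lieSpan (Set.mem_insert_of_mem _ rfl)
  obtain ⟨h1, h2⟩ := ad_pow_zass hn hr (by omega) c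
  rw [← hy] at h1 h2
  set T := LieAlgebra.ad F (WittAlg F p n) y with hT
  have hTG : ∀ v ∈ G.toSubmodule, T v ∈ G.toSubmodule := fun v hv => G.lie_mem hyG hv
  have hPx : Polynomial.aeval T P (zass F p n (divPow F p n r)) = x := by
    rw [hxg, hga, map_sum, map_sum, LinearMap.sum_apply]
    refine Finset.sum_congr rfl fun i hi => ?_
    rw [Polynomial.aeval_monomial, Module.End.mul_apply, h1 i (Finset.mem_range.1 hi), map_smul]
    rfl
  -- (1 + 2c x^(r)) - c x^(r) = 1 + c x^(r).
  have hXy : Polynomial.aeval T (Polynomial.X ^ r - Polynomial.C c)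
      (zass F p n (divPow F p n r)) = y := by
    rw [map_sub, map_pow, Polynomial.aeval_X, Polynomial.aeval_C, LinearMap.sub_apply, h2,
      Module.algebraMap_end_apply, ← map_smul, ← map_sub, hy]
    congr 1
    rw [two_mul, add_smul]
    abel
  have htop : zass F p n (divPow F p n r) ∈ G := by
    -- The relation A P + B (X^r - c) = 1, applied to x^(r) D, reads A(T) x + B(T) y = x^(r) D.
    have h3 := congrArg (fun Q => Polynomial.aeval T Q (zass F p n (divPow F p n r))) hAB
    simp only [map_add, map_mul, LinearMap.add_apply, Module.End.mul_apply, hPx, hXy, map_one,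
      Module.End.one_apply] at h3
    rw [← h3]
    exact add_mem (Submodule.aeval_apply_mem hTG A hxG) (Submodule.aeval_apply_mem hTG B hyG)
  refine eq_top_of_ev_ne_zero hn (g := 1 + c • divPow F p n r) ?_ hyG
    (by rwa [hr, Nat.add_sub_cancel])
  rw [map_add, ev_one, map_smul, divPow, ev_mon, smul_zero, add_zero]
  · exact one_ne_zero
  · intro h
    have := congrFun h 0
    rw [Pi.zero_apply] at this
    omega

end Zassenhaus

end DPAlg

/-! ### The theorem. -/

open DPAlg

theorem theoremC (p : ℕ) [Fact p.Prime] (hp : 3 < p)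
    (F : Type*) [Field F] [IsAlgClosed F] [CharP F p]
    (m : ℕ) (hm : 1 ≤ m) (n : Fin m → ℕ) (hn : ∀ i, 1 ≤ n i) :
    (GeneratedByOneAndAHalf F (WittAlg F p n) ↔ m = 1) ∧
    (1 < m → ∀ x ∈ WittAlg.component F p n (WittAlg.maxDegree p n), ∀ y : WittAlg F p n,
      LieSubalgebra.lieSpan F (WittAlg F p n) {x, y} ≠ ⊤) := by
  refine ⟨⟨fun h => ?_, ?_⟩, fun hm1 x hx y => lieSpan_pair_ne_top hm1 hn hx y⟩
  · by_contra hm1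
    have hm2 : 1 < m := by omega
    let i : Fin m := ⟨0, hm⟩
    -- The non-zero element x^(τ) D_1 of the top component refutes generation by one and a half
    -- elements.
    let x : WittAlg F p n := ofCoeffs F p n (Pi.single i (mon F p n (topIndex p n)))
    have hx0 : x ≠ 0 := by
      intro h0
      have h1 := wittAction_ofCoeffs_mon hn (Pi.single i (mon F p n (topIndex p n))) i
      rw [show ofCoeffs F p n (Pi.single i (mon F p n (topIndex p n))) = 0 from h0, map_zero,
        Derivation.zero_apply, Pi.single_eq_same] at h1
      have h2 := congrArg (coeff F p n (topIndex p n)) h1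
      rw [map_zero, coeff_mon (le_topIndex.1 le_rfl), if_pos rfl] at h2
      exact zero_ne_one h2
    have hx : x ∈ WittAlg.component F p n (WittAlg.maxDegree p n) := by
      refine Submodule.subset_span ⟨topIndex p n, i, le_topIndex.1 le_rfl, ?_, ?_⟩
      · rw [WittAlg.maxDegree, Nat.cast_sum]
        congr 1
        refine Finset.sum_congr rfl fun j _ => ?_
        rw [topIndex, Nat.cast_sub (Nat.one_le_pow _ _ (Fact.out : p.Prime).pos)]
        simp
      · change ∑ j, (Pi.single i (mon F p n (topIndex p n)) : Fin m → trunc F p n) j •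
          partialD F j = _
        rw [Finset.sum_eq_single i, Pi.single_eq_same]
        · rw [← coe_mon (le_topIndex.1 le_rfl)]
          rfl
        · intro j _ hj
          rw [Pi.single_eq_of_ne hj, zero_smul]
        · exact fun h => absurd (Finset.mem_univ i) h
    obtain ⟨y, hy⟩ := h x hx0
    exact lieSpan_pair_ne_top hm2 hn hx y hy
  · rintro rfl
    exact generatedByOneAndAHalf_zassenhaus hp hn
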